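/- **Conventions.** All functions and polynomials are real valued; $\mathcal P_d(\mathbb R^n)$ is the space of polynomials of total degree at most $d$, and $\|g\|_K=\sup_K|g|$. A compact set $K\subset\mathbb R^n$ is *fat* if it is the closure of its interior. For $K$ fat, $C^m(K)$ is the space of functions that are $m$ times continuously differentiable on the interior of $K$ and whose derivatives of order $\le m$ all extend continuously to $K$, with the norm $\max_{|\alpha|\le m}\|D^\alpha f\|_K$. * $K$ is *$\theta$-strong-Bernstein–Markov* ($\theta>0$) if there are a probability measure $\mu$ on $K$ and a constant $C$ with $\|p\|_K\le C(\deg p)^\theta\big(\int_K p^2\,d\mu\big)^{1/2}$ for all non-constant polynomials $p$. * $K$ satisfies a *Markov inequality of exponent $r$* if for some $M_K>0$, $\|D^\alpha p\|_K\le M_K(\deg p)^{r|\alpha|}\|p\|_K$ for all polynomials $p$ and all multi-indices $\alpha$. * $K$ is a *Jackson set* if for every $m\in\mathbb N$ and $f\in C^m(K)$ there is a constant $M_J$ with $\operatorname{dist}_{\|\cdot\|_K}(f,\mathcal P_d(\mathbb R^n))\le M_J\,d^{-m}$ for all $d\ge1$. * A *polynomial projector of degree $d$* on $C^m(K)$ is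 a continuous linear projector $\Pi$ of $C^m(K)$ onto $\mathcal P_d(\mathbb R^n)$; its space of interpolation conditions is $\mathcal I(\Pi)=\{\nu\in C^m(K)' : \nu(f)=\nu(\Pi f)\ \text{for all } f\}$. A *Newton sequence* on $C^m(K)$ is a sequence $\mathcal N=(\Pi_0,\Pi_1,\dots)$ of polynomial projectors, $\Pi_d$ of degree $d$, with $\mathcal I(\Pi_d)\subset\mathcal I(\Pi_{d+1})$ for all $d$. For a compact set $\kappa\subset K$ and $E\subset C^m(K)$, $\mathcal N$ is *$C(\kappa)$-converging on $E$* if $\Pi_d f\to f$ uniformly on $\kappa$ for every $f\in E$. * Let $\mathcal N^s=(\Pi^s_0,\Pi^s_1,\dots)$ be Newton sequences on $C^{\overline m}(K_s)$, $s=1,2$. For continuous linear forms $\mu,\nu$ on $C^{\overline m}(K_1)$, $C^{\overline m}(K_2)$, a continuous linear form $\lambda$ on $C^q(K_1\times K_2)$ is the tensor product $\mu\otimes\nu$ if for every $f\in C^q(K_1\times K_2)$ one has $f(x,\cdot)\in C^{\overline m}(K_2)$ for all $x\in K_1$, the function $x\mapsto\nu(f(x,\cdot))$ belongs to $C^{\overline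 m}(K_1)$, and $\lambda(f)=\mu\big(x\mapsto\nu(f(x,\cdot))\big)$. A Newton sequence $(\Pi_0,\Pi_1,\dots)$ on $C^q(K_1\times K_2)$ is a *Newton product* $\mathcal N^1\boxtimes\mathcal N^2$ on $C^q(K_1\times K_2)$ if for every $d$ the space $\mathcal I(\Pi_d)$ is spanned by the tensor products $\mu\otimes\nu$ (those that exist on $C^q(K_1\times K_2)$) with $\mu\in\mathcal I(\Pi^1_i)$, $\nu\in\mathcal I(\Pi^2_j)$, $i+j\le d$. **Theorem.** Let $n_1,n_2\ge1$ and, for $s=1,2$, let $K_s\subset\mathbb R^{n_s}$ be a fat compact set that is $\theta_s$-strong-Bernstein–Markov and satisfies a Markov inequality of exponent $r_s$, and let $\kappa_s\subset K_s$ be compact. Assume that $K=K_1\times K_2$ is a Jackson set in $\mathbb R^{n_1+n_2}$ and put $\kappa=\kappa_1\times\kappa_2$. Let $\overline m\le m$ and $\mathbf m$ be natural numbers, and let $\mathcal N^s$ be a Newton sequence on $C^{\overline m}(K_s)$ that is $C(\kappa_s)$-converging on $C^m(K_s)$, $s=1,2$. If $$\mathbf m>\tfrac32+(\theta_1+\theta_2)+m(r_1+r_2),$$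 then there is exactly one Newton product $\mathcal N^1\boxtimes\mathcal N^2$ on $C^{\mathbf m}(K)$, and it is $C(\kappa)$-converging on $C^{\mathbf m}(K)$. More generally, for every natural number $q\le\mathbf m$, every Newton product $\mathcal N^1\boxtimes\mathcal N^2$ on $C^q(K)$ (if one exists) is $C(\kappa)$-converging on $C^{\mathbf m}(K)\subset C^q(K)$. -/

import Mathlib

open Filter Topology MeasureTheory

noncomputable section

/-- The partial derivative `∂_{w 0} ∂_{w 1} ⋯ ∂_{w (k-1)} f` at `x`, of order `k`.  For functions of
class `C^k` these are exactly the derivatives `D^α f` with `|α| = k` (`α i` is the number of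
occurrences of the coordinate `i` in `w`). -/
def wordDeriv {ι : Type*} [Fintype ι] [DecidableEq ι] {k : ℕ} (w : Fin k → ι)
    (f : (ι → ℝ) → ℝ) (x : ι → ℝ) : ℝ :=
  iteratedFDeriv ℝ k f x (fun j => Pi.single (w j) (1 : ℝ))

/-- Labels of the partial derivatives of order at most `m` in the coordinates `ι`. -/
abbrev DerivIndex (ι : Type*) (m : ℕ) : Type _ := Σ k : Fin (m + 1), (Fin (k : ℕ) → ι)

/-- The label of the derivative of order zero. -/
def zeroIndex (ι : Type*) (m : ℕ) : DerivIndex ι m := ⟨0, fun j => j.elim0⟩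

/-- The space `C^m(K)` for a fat compact set `K`: a function that is `m` times continuously
differentiable on the interior of `K` and all of whose derivatives of order `≤ m` extend
continuously to `K`, stored together with these (unique, as `K` is fat) continuous extensions.
The topology induced from the finite product of copies of `C(K, ℝ)` is the one given by the norm
`max_{|α| ≤ m} sup_K |D^α f|`. -/
def cmSubmodule {ι : Type*} [Fintype ι] [DecidableEq ι] (m : ℕ) (K : Set (ι → ℝ)) :
    Submodule ℝ (DerivIndex ι m → C(K, ℝ)) where
  carrier := {F | ∃ f : (ι → ℝ) → ℝ, ContDiffOn ℝ m f (interior K) ∧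
    ∀ (w : DerivIndex ι m) (x : K), (x : ι → ℝ) ∈ interior K → F w x = wordDeriv w.2 f x}
  zero_mem' := by
    refine ⟨0, contDiffOn_const, fun w x _ => ?_⟩
    have : iteratedFDeriv ℝ (w.1 : ℕ) (0 : (ι → ℝ) → ℝ) = 0 := iteratedFDeriv_fun_zero
    simp [wordDeriv, this]
  add_mem' := by
    rintro F G ⟨f, hf, hF⟩ ⟨g, hg, hG⟩
    refine ⟨f + g, hf.add hg, fun w x hx => ?_⟩
    have hw : ((w.1 : ℕ) : WithTop ℕ∞) ≤ (m : WithTop ℕ∞) := by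
      exact_mod_cast Nat.lt_succ_iff.mp w.1.2
    have hf' : ContDiffAt ℝ (w.1 : ℕ) f x :=
      (hf.contDiffAt (isOpen_interior.mem_nhds hx)).of_le hw
    have hg' : ContDiffAt ℝ (w.1 : ℕ) g x :=
      (hg.contDiffAt (isOpen_interior.mem_nhds hx)).of_le hw
    simp only [Pi.add_apply, ContinuousMap.add_apply, hF w x hx, hG w x hx, wordDeriv,
      iteratedFDeriv_add_apply hf' hg', add_apply]
  smul_mem' := by
    rintro c F ⟨f, hf, hF⟩
    refine ⟨c • f, hf.const_smul c, fun w x hx => ?_⟩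
    have hw : ((w.1 : ℕ) : WithTop ℕ∞) ≤ (m : WithTop ℕ∞) := by
      exact_mod_cast Nat.lt_succ_iff.mp w.1.2
    have hf' : ContDiffAt ℝ (w.1 : ℕ) f x :=
      (hf.contDiffAt (isOpen_interior.mem_nhds hx)).of_le hw
    simp only [Pi.smul_apply, ContinuousMap.smul_apply, hF w x hx, wordDeriv,
      iteratedFDeriv_const_smul_apply hf', smul_apply]

/-- The topological vector space `C^m(K)`. -/
abbrev CmSpace {ι : Type*} [Fintype ι] [DecidableEq ι] (m : ℕ) (K : Set (ι → ℝ)) : Type _ :=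
  ↥(cmSubmodule m K)

/-- The underlying continuous function on `K` of an element of `C^m(K)`. -/
def CmSpace.toMap {ι : Type*} [Fintype ι] [DecidableEq ι] {m : ℕ} {K : Set (ι → ℝ)}
    (f : CmSpace m K) : C(K, ℝ) :=
  f.1 (zeroIndex ι m)

/-- The polynomials of total degree at most `d`, as a subspace of `C^m(K)`. -/
def polySubmodule {ι : Type*} [Fintype ι] [DecidableEq ι] (m : ℕ) (K : Set (ι → ℝ)) (d : ℕ) :
    Submodule ℝ (CmSpace m K) where
  carrier := {f | ∃ p : MvPolynomial ι ℝ, p.totalDegree ≤ d ∧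
    ∀ x : K, f.toMap x = MvPolynomial.eval (x : ι → ℝ) p}
  zero_mem' := ⟨0, by simp, fun x => by simp [CmSpace.toMap]⟩
  add_mem' := by
    rintro f g ⟨p, hp, hfp⟩ ⟨q, hq, hgq⟩
    refine ⟨p + q, (MvPolynomial.totalDegree_add p q).trans (max_le hp hq), fun x => ?_⟩
    rw [map_add, ← hfp x, ← hgq x]
    rfl
  smul_mem' := by
    rintro c f ⟨p, hp, hfp⟩
    refine ⟨c • p, (MvPolynomial.totalDegree_smul_le c p).trans hp, fun x => ?_⟩
    rw [MvPolynomial.smul_eval, ← hfp x]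
    rfl

/-- `P` is a polynomial projector of degree `d` on `C^m(K)`: a continuous linear projector onto the
space of polynomials of total degree at most `d`. -/
def IsPolyProjector {ι : Type*} [Fintype ι] [DecidableEq ι] {m : ℕ} {K : Set (ι → ℝ)} (d : ℕ)
    (P : CmSpace m K →L[ℝ] CmSpace m K) : Prop :=
  (∀ f, P (P f) = P f) ∧ LinearMap.range (P : CmSpace m K →ₗ[ℝ] CmSpace m K) = polySubmodule m K d

/-- The space of interpolation conditions of `P`: all continuous linear forms `ν` on `C^m(K)` with
`ν f = ν (P f)` for every `f`. -/
def interpSpace {ι : Type*} [Fintype ι] [DecidableEq ι] {m : ℕ} {K : Set (ι → ℝ)}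
    (P : CmSpace m K →L[ℝ] CmSpace m K) : Submodule ℝ (CmSpace m K →L[ℝ] ℝ) where
  carrier := {ν | ∀ f, ν f = ν (P f)}
  zero_mem' := fun _ => rfl
  add_mem' := by
    intro a b ha hb f
    simp only [add_apply]
    rw [ha f, hb f]
  smul_mem' := by
    intro c a ha f
    simp only [smul_apply]
    rw [ha f]

/-- A Newton sequence on `C^m(K)`: a sequence of polynomial projectors, the `d`-th one of degree
`d`, whose spaces of interpolation conditions increase. -/
structure NewtonSequence {ι : Type*} [Fintype ι] [DecidableEq ι] (m : ℕ) (K : Set (ι → ℝ)) where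
  proj : ℕ → (CmSpace m K →L[ℝ] CmSpace m K)
  isPolyProjector : ∀ d, IsPolyProjector d (proj d)
  interpSpace_le : ∀ d, interpSpace (proj d) ≤ interpSpace (proj (d + 1))

/-- A Newton sequence on `C^a(K)` is `C(κ)`-converging on the subspace `C^b(K)` (here `a ≤ b` and
`κ ⊆ K`): `Π_d f → f` uniformly on `κ` for every `f` in `C^a(K)` that lies in `C^b(K)`. -/
def NewtonSequence.ConvergingOn {ι : Type*} [Fintype ι] [DecidableEq ι] {a : ℕ}
    {K : Set (ι → ℝ)} (N : NewtonSequence a K) (κ : Set (ι → ℝ)) (b : ℕ) : Prop :=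
  ∀ f : CmSpace a K, (∃ g : CmSpace b K, g.toMap = f.toMap) →
    TendstoUniformlyOn (fun (d : ℕ) (x : K) => (N.proj d f).toMap x) (fun x : K => f.toMap x)
      atTop {x : K | (x : ι → ℝ) ∈ κ}

/-- The Cartesian product `A × B`, with `ℝ^{ι₁} × ℝ^{ι₂}` identified with `ℝ^{ι₁ ⊕ ι₂}`. -/
def prodSet {ι₁ ι₂ : Type*} (A : Set (ι₁ → ℝ)) (B : Set (ι₂ → ℝ)) : Set (ι₁ ⊕ ι₂ → ℝ) :=
  {z | (fun i => z (Sum.inl i)) ∈ A ∧ (fun j => z (Sum.inr j)) ∈ B}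

/-- The point `(x, y)` of `A × B`. -/
def prodPoint {ι₁ ι₂ : Type*} {A : Set (ι₁ → ℝ)} {B : Set (ι₂ → ℝ)} (x : A) (y : B) :
    prodSet A B :=
  ⟨Sum.elim (x : ι₁ → ℝ) (y : ι₂ → ℝ), x.2, y.2⟩

/-- The continuous linear form `lam` on `C^q(K₁ × K₂)` is the tensor product `μ ⊗ ν`:
`lam f = μ (x ↦ ν (f (x, ·)))`, where it is part of the definition that `f (x, ·)` belongs to
`C^a(K₂)` for each `x` and that `x ↦ ν (f (x, ·))` belongs to `C^a(K₁)`. -/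
def IsTensor {ι₁ ι₂ : Type*} [Fintype ι₁] [DecidableEq ι₁] [Fintype ι₂] [DecidableEq ι₂]
    {a q : ℕ} {K₁ : Set (ι₁ → ℝ)} {K₂ : Set (ι₂ → ℝ)}
    (μ : CmSpace a K₁ →L[ℝ] ℝ) (ν : CmSpace a K₂ →L[ℝ] ℝ)
    (lam : CmSpace q (prodSet K₁ K₂) →L[ℝ] ℝ) : Prop :=
  ∀ f : CmSpace q (prodSet K₁ K₂), ∃ (F : K₁ → CmSpace a K₂) (g : CmSpace a K₁),
    (∀ (x : K₁) (y : K₂), (F x).toMap y = f.toMap (prodPoint x y)) ∧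
    (∀ x : K₁, g.toMap x = ν (F x)) ∧ lam f = μ g

/-- `N` is the Newton product of `N₁` and `N₂`: the interpolation conditions of the `d`-th projector
of `N` are spanned by the tensor products `μ ⊗ ν` of interpolation conditions `μ` of `Π¹_i` and
`ν` of `Π²_j`, `i + j ≤ d`.  (If the conditions of `Π^s_d` form the direct sum of spaces `J^s_i`,
`i ≤ d`, this is the direct sum of the `J¹_i ⊗ J²_j`, `i + j ≤ d`.) -/
def IsNewtonProduct {ι₁ ι₂ : Type*} [Fintype ι₁] [DecidableEq ι₁] [Fintype ι₂] [DecidableEq ι₂]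
    {a q : ℕ} {K₁ : Set (ι₁ → ℝ)} {K₂ : Set (ι₂ → ℝ)}
    (N₁ : NewtonSequence a K₁) (N₂ : NewtonSequence a K₂)
    (N : NewtonSequence q (prodSet K₁ K₂)) : Prop :=
  ∀ d : ℕ, interpSpace (N.proj d) =
    Submodule.span ℝ {lam | ∃ i j : ℕ, i + j ≤ d ∧ ∃ μ ∈ interpSpace (N₁.proj i),
      ∃ ν ∈ interpSpace (N₂.proj j), IsTensor μ ν lam}

/-- The uniform norm of a (bounded) function on a set. -/
def supNormOn {X : Type*} (K : Set X) (g : K → ℝ) : ℝ := ⨆ x : K, |g x|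

/-- `K` is a `θ`-strong-Bernstein–Markov compact: for some probability measure `μ` on `K`,
`‖p‖_K ≤ C (deg p)^θ ‖p‖_{L²(μ)}` for all non-constant polynomials `p` (for constants one has
`‖p‖_K = ‖p‖_{L²(μ)}`). -/
def IsSBM {ι : Type*} [Fintype ι] (K : Set (ι → ℝ)) (θ : ℝ) : Prop :=
  0 < θ ∧ ∃ μ : Measure (ι → ℝ), IsProbabilityMeasure μ ∧ μ Kᶜ = 0 ∧
    ∃ C : ℝ, ∀ p : MvPolynomial ι ℝ, p.totalDegree ≠ 0 →
      supNormOn K (fun x => MvPolynomial.eval (x : ι → ℝ) p) ≤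
        C * (p.totalDegree : ℝ) ^ θ * Real.sqrt (∫ x in K, (MvPolynomial.eval x p) ^ 2 ∂μ)

/-- `K` satisfies a Markov inequality of exponent `r`. -/
def SatisfiesMarkov {ι : Type*} [Fintype ι] [DecidableEq ι] (K : Set (ι → ℝ)) (r : ℝ) : Prop :=
  ∃ M : ℝ, 0 < M ∧ ∀ (p : MvPolynomial ι ℝ) (k : ℕ) (w : Fin k → ι),
    supNormOn K (fun x => wordDeriv w (fun y => MvPolynomial.eval y p) (x : ι → ℝ)) ≤
      M * (p.totalDegree : ℝ) ^ (r * (k : ℝ)) *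
        supNormOn K (fun x => MvPolynomial.eval (x : ι → ℝ) p)

/-- `K` is a Jackson set: for every `m` and `f ∈ C^m(K)` the uniform distance on `K` of `f` to the
polynomials of degree at most `d` is at most `M d^{-m}`, with `M` independent of `d ≥ 1`. -/
def IsJackson {ι : Type*} [Fintype ι] [DecidableEq ι] (K : Set (ι → ℝ)) : Prop :=
  ∀ (m : ℕ) (f : CmSpace m K), ∃ M : ℝ, ∀ d : ℕ, 1 ≤ d →
    (⨅ p : {p : MvPolynomial ι ℝ // p.totalDegree ≤ d},
      supNormOn K (fun x => f.toMap x - MvPolynomial.eval (x : ι → ℝ) p.1)) ≤ M / (d : ℝ) ^ m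

/-- A fat compact set: a compact set that is the closure of its interior. -/
def IsFatCompact {X : Type*} [TopologicalSpace X] (K : Set X) : Prop :=
  IsCompact K ∧ closure (interior K) = K

end

noncomputable section

/-! The `d`-th projector of the Newton product is `Π_d = ∑_{s ≤ d} Δ_s ⊗ Π²_{d-s}`, where `Δ_s =
Π¹_s - Π¹_{s-1}` and `Π¹_{-1} = 0`. Telescoping and the nesting of the interpolation spaces show
that it reproduces polynomials of degree at most `d` and that its conditions are the required tensor
products (`PartialMaps.exists_newtonProduct`). A projector is determined by its conditions, whence
uniqueness; comparing restricted conditions reduces a product on `C^q` to the one on `C^M`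
(`IsNewtonProduct.proj_incl`).

The analysis rests on approximants `P_l` of `f` of degree at most `2^l`. Jackson gives the error
`2^{-lM}`, and Markov, applied in each group of variables, bounds the derivatives of `P_{l+1} - P_l`
of order at most `m` in each group by a multiple of `τ^l`, `τ = 2^{m(r₁+r₂)-M}`
(`exists_isGeomApprox`). Hence sections and partial applications of the `P_l` converge in the
complete spaces `C^a(K_s)`, and the closed graph theorem makes the limits continuous in `f`: all the
tensor products exist (`nonempty_partialMaps`).

For convergence, Banach–Steinhaus bounds the values of `Π^s_d` on `κ_s` by the `C^m` norm, uniformly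
in `d`. On a polynomial of degree at most `n` only the terms `s ≤ n` of `Π_d` survive, so its values
on `κ` are at most a multiple of `n + 1` times the mixed norm, whatever `d` is
(`PartialMaps.abs_sum_tens_le`). With `n = 2^{l+1}` the increments contribute `O((2τ)^l)`, which is
summable because `M > 1 + m(r₁+r₂)`. Since `Π_d P_k = P_k` once `2^k ≤ d`, the error on `κ` is
`O((2τ)^k)`. -/

/-- The extension by zero of a function on `K`. -/
def zeroExtend {ι : Type*} {K : Set (ι → ℝ)} (g : K → ℝ) : (ι → ℝ) → ℝ :=
  Function.extend Subtype.val g 0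

theorem zeroExtend_apply {ι : Type*} {K : Set (ι → ℝ)} (g : K → ℝ) {x : ι → ℝ} (hx : x ∈ K) :
    zeroExtend g x = g ⟨x, hx⟩ :=
  Subtype.val_injective.extend_apply g 0 ⟨x, hx⟩

/-! ### The Banach space `C^m(K)`. -/

section CmSpace

variable {ι : Type*} [Fintype ι] [DecidableEq ι]

theorem differentiableAt_wordDeriv {k : ℕ} (w : Fin k → ι) {f : (ι → ℝ) → ℝ} {x : ι → ℝ}
    (hf : ContDiffAt ℝ (k + 1 : ℕ) f x) : DifferentiableAt ℝ (wordDeriv w f) x :=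
  (hf.differentiableAt_iteratedFDeriv (by exact_mod_cast k.lt_succ_self)).continuousMultilinear_apply_const _

theorem wordDeriv_succ {k : ℕ} (w : Fin (k + 1) → ι) {f : (ι → ℝ) → ℝ} {x : ι → ℝ}
    (hf : ContDiffAt ℝ (k + 1 : ℕ) f x) :
    wordDeriv w f x = fderiv ℝ (wordDeriv (Fin.tail w) f) x (Pi.single (w 0) 1) := by
  have hd : DifferentiableAt ℝ (iteratedFDeriv ℝ k f) x :=
    hf.differentiableAt_iteratedFDeriv (by exact_mod_cast k.lt_succ_self)
  have := fderiv_continuousMultilinear_apply_const_apply hd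
    (fun j => Pi.single (Fin.tail w j) (1 : ℝ)) (Pi.single (w 0) 1)
  unfold wordDeriv
  rw [this, iteratedFDeriv_succ_apply_left]
  rfl

theorem wordDeriv_zero (w : Fin 0 → ι) (f : (ι → ℝ) → ℝ) : wordDeriv w f = f := by
  ext x
  simp [wordDeriv]

theorem wordDeriv_congr {k : ℕ} (w : Fin k → ι) {f g : (ι → ℝ) → ℝ} {x : ι → ℝ}
    (h : f =ᶠ[𝓝 x] g) : wordDeriv w f x = wordDeriv w g x := by
  unfold wordDeriv
  rw [(h.iteratedFDeriv ℝ k).eq_of_nhds]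

theorem ContinuousLinearMap.eq_sum_apply_single_smul_proj (L : (ι → ℝ) →L[ℝ] ℝ) :
    L = ∑ i, L (Pi.single i 1) • (ContinuousLinearMap.proj i : (ι → ℝ) →L[ℝ] ℝ) := by
  ext v
  have h : v = ∑ i, v i • (Pi.single i (1 : ℝ) : ι → ℝ) := by
    ext j; simp [Finset.sum_apply, Pi.single_apply]
  conv_lhs => rw [h]
  simp [mul_comm]

/-- The differential assembled from the candidate partial derivatives of the next order. -/
def wordGradient {m : ℕ} {K : Set (ι → ℝ)} (F : DerivIndex ι m → C(K, ℝ)) {k : ℕ} (hk : k < m)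
    (w : Fin k → ι) (x : ι → ℝ) : (ι → ℝ) →L[ℝ] ℝ :=
  ∑ i, zeroExtend (F ⟨⟨k + 1, by omega⟩, Fin.cons i w⟩) x •
    (ContinuousLinearMap.proj i : (ι → ℝ) →L[ℝ] ℝ)

/-- Descending induction on the order of the derivative, with `j` orders left: the top components
are only continuous, and each lower one has a differential built from components one order higher.
-/
theorem contDiffOn_zeroExtend {m : ℕ} {K : Set (ι → ℝ)} (F : DerivIndex ι m → C(K, ℝ))
    (hF : ∀ (k : ℕ) (hk : k < m) (w : Fin k → ι), ∀ x ∈ interior K,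
      HasFDerivAt (zeroExtend (F ⟨⟨k, by omega⟩, w⟩)) (wordGradient F hk w x) x) (j : ℕ) :
    ∀ (k : ℕ) (hk : k + j = m) (w : Fin k → ι),
      ContDiffOn ℝ j (zeroExtend (F ⟨⟨k, by omega⟩, w⟩)) (interior K) := by
  induction j with
  | zero =>
    intro k hk w
    rw [Nat.cast_zero, contDiffOn_zero, continuousOn_iff_continuous_domRestrict]
    have h : Set.domRestrict (interior K) (zeroExtend (F ⟨⟨k, by omega⟩, w⟩)) =
        fun x : interior K => F ⟨⟨k, by omega⟩, w⟩ ⟨x, interior_subset x.2⟩ := by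
      ext x
      exact zeroExtend_apply _ _
    rw [h]
    fun_prop
  | succ j ih =>
    intro k hk w
    rw [Nat.cast_succ, contDiffOn_succ_iff_fderiv_of_isOpen isOpen_interior]
    refine ⟨fun x hx => (hF k (by omega) w x hx).differentiableAt.differentiableWithinAt,
      fun h => absurd h (by simp), ?_⟩
    refine ContDiffOn.congr (f := wordGradient F (by omega) w) ?_
      fun x hx => (hF k (by omega) w x hx).fderiv
    unfold wordGradient
    exact ContDiffOn.sum fun i _ => (ih (k + 1) (by omega) _).smul contDiffOn_const

/-- Replaces the unspecified `C^m` function by first-order relations between stored components of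
consecutive orders, a condition that survives uniform limits. Conversely, the order-zero component
itself serves as the `C^m` function. -/
theorem mem_cmSubmodule_iff {m : ℕ} {K : Set (ι → ℝ)} (F : DerivIndex ι m → C(K, ℝ)) :
    F ∈ cmSubmodule m K ↔ ∀ (k : ℕ) (hk : k < m) (w : Fin k → ι), ∀ x ∈ interior K,
      HasFDerivAt (zeroExtend (F ⟨⟨k, by omega⟩, w⟩)) (wordGradient F hk w x) x := by
  constructor
  · rintro ⟨f, hf, hFf⟩ k hk w x hx
    have hfx : ContDiffAt ℝ (k + 1 : ℕ) f x :=
      (hf.contDiffAt (isOpen_interior.mem_nhds hx)).of_le (by exact_mod_cast hk)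
    have hd := (differentiableAt_wordDeriv w hfx).hasFDerivAt
    have hgrad : wordGradient F hk w x = fderiv ℝ (wordDeriv w f) x := by
      rw [ContinuousLinearMap.eq_sum_apply_single_smul_proj (fderiv ℝ (wordDeriv w f) x)]
      refine Finset.sum_congr rfl fun i _ => ?_
      rw [zeroExtend_apply _ (interior_subset hx), hFf _ _ hx, wordDeriv_succ _ hfx]
      simp
    rw [hgrad]
    refine hd.congr_of_eventuallyEq ?_
    filter_upwards [isOpen_interior.mem_nhds hx] with y hy
    rw [zeroExtend_apply _ (interior_subset hy), hFf _ _ hy]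
  · intro hF
    have hcd := contDiffOn_zeroExtend F hF m 0 (by omega) (fun j => j.elim0)
    refine ⟨_, hcd, ?_⟩
    suffices H : ∀ (k : ℕ) (hk : k ≤ m) (w : Fin k → ι), ∀ x ∈ interior K,
        zeroExtend (F ⟨⟨k, by omega⟩, w⟩) x =
          wordDeriv w (zeroExtend (F ⟨⟨0, by omega⟩, fun j => j.elim0⟩)) x by
      rintro ⟨⟨k, hk⟩, w⟩ x hx
      rw [← H k (by omega) w x hx, zeroExtend_apply _ (interior_subset hx)]
    intro k
    induction k with
    | zero =>
      intro hk w x hx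
      rw [wordDeriv_zero, Subsingleton.elim w]
    | succ k ih =>
      intro hk w x hx
      have hfx := ((hcd.contDiffAt (isOpen_interior.mem_nhds hx)).of_le
        (show ((k + 1 : ℕ) : WithTop ℕ∞) ≤ m by exact_mod_cast hk))
      rw [wordDeriv_succ w hfx]
      have he : wordDeriv (Fin.tail w) (zeroExtend (F ⟨⟨0, by omega⟩, fun j => j.elim0⟩)) =ᶠ[𝓝 x]
          zeroExtend (F ⟨⟨k, by omega⟩, Fin.tail w⟩) := by
        filter_upwards [isOpen_interior.mem_nhds hx] with y hy
        rw [ih (by omega) _ y hy]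
      rw [he.fderiv_eq, (hF k (by omega) (Fin.tail w) x hx).fderiv]
      simp [wordGradient, Pi.single_apply]

theorem tendstoUniformlyOn_wordGradient {m : ℕ} {K : Set (ι → ℝ)} [CompactSpace K]
    {F : ℕ → DerivIndex ι m → C(K, ℝ)} {G : DerivIndex ι m → C(K, ℝ)}
    (h : Tendsto F atTop (𝓝 G)) {k : ℕ} (hk : k < m) (w : Fin k → ι) :
    TendstoUniformlyOn (fun n => wordGradient (F n) hk w) (wordGradient G hk w) atTop
      (interior K) := by
  have hd : Tendsto (fun n => ∑ i : ι, ‖F n ⟨⟨k + 1, by omega⟩, Fin.cons i w⟩ -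
      G ⟨⟨k + 1, by omega⟩, Fin.cons i w⟩‖ *
      ‖(ContinuousLinearMap.proj i : (ι → ℝ) →L[ℝ] ℝ)‖) atTop (𝓝 0) := by
    rw [← Finset.sum_const_zero (s := (Finset.univ : Finset ι))]
    refine tendsto_finsetSum _ fun i _ => ?_
    have := (tendsto_iff_norm_sub_tendsto_zero.1
      (tendsto_pi_nhds.1 h ⟨⟨k + 1, by omega⟩, Fin.cons i w⟩)).mul_const
      ‖(ContinuousLinearMap.proj i : (ι → ℝ) →L[ℝ] ℝ)‖
    simpa using this
  rw [Metric.tendstoUniformlyOn_iff]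
  intro ε hε
  filter_upwards [(tendsto_order.1 hd).2 ε hε] with n hn x hx
  refine lt_of_le_of_lt ?_ hn
  rw [dist_comm, dist_eq_norm]
  unfold wordGradient
  rw [← Finset.sum_sub_distrib]
  refine (norm_sum_le _ _).trans (Finset.sum_le_sum fun i _ => ?_)
  refine (congrArg norm (sub_smul _ _ (ContinuousLinearMap.proj i : (ι → ℝ) →L[ℝ] ℝ))).symm.trans_le
    ?_
  rw [norm_smul]
  gcongr
  rw [zeroExtend_apply _ (interior_subset hx), zeroExtend_apply _ (interior_subset hx)]
  exact (F n _ - G _).norm_coe_le_norm _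

/-- Uniform convergence of the differentials and pointwise convergence of the functions preserve the
first-order relations. The resulting completeness serves the Cauchy limits, the closed graph theorem
and Banach–Steinhaus. -/
theorem isClosed_cmSubmodule (m : ℕ) (K : Set (ι → ℝ)) [CompactSpace K] :
    IsClosed (cmSubmodule m K : Set (DerivIndex ι m → C(K, ℝ))) := by
  refine IsSeqClosed.isClosed fun F G hF hG => ?_
  rw [SetLike.mem_coe, mem_cmSubmodule_iff]
  intro k hk w x hx
  refine hasFDerivAt_of_tendstoUniformlyOn isOpen_interior
    (tendstoUniformlyOn_wordGradient hG hk w)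
    (fun n x hx => (mem_cmSubmodule_iff (F n)).1 (hF n) k hk w x hx) (fun y hy => ?_) hx
  simp only [zeroExtend_apply _ (interior_subset hy)]
  exact ((continuous_eval_const _).tendsto _).comp (tendsto_pi_nhds.1 hG _)

instance completeSpace_cmSpace (m : ℕ) (K : Set (ι → ℝ)) [CompactSpace K] :
    CompleteSpace (CmSpace m K) :=
  (isClosed_cmSubmodule m K).completeSpace_coe

/-- Values determine derivatives on the interior, and fatness makes the interior dense, so the
continuous extensions agree too. -/
theorem CmSpace.ext_toMap {m : ℕ} {K : Set (ι → ℝ)} (hK : closure (interior K) = K)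
    {f g : CmSpace m K} (h : ∀ x, f.toMap x = g.toMap x) : f = g := by
  obtain ⟨f', -, hf⟩ := f.2
  obtain ⟨g', -, hg⟩ := g.2
  have hfg : ∀ x ∈ interior K, f' x = g' x := by
    intro x hx
    have h1 : f.toMap ⟨x, interior_subset hx⟩ = f' x :=
      (hf (zeroIndex ι m) _ hx).trans (congrFun (wordDeriv_zero _ f') x)
    have h2 : g.toMap ⟨x, interior_subset hx⟩ = g' x :=
      (hg (zeroIndex ι m) _ hx).trans (congrFun (wordDeriv_zero _ g') x)
    rw [← h1, ← h2, h]
  refine Subtype.ext (funext fun w => ?_)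
  have hdense : Dense {x : K | (x : ι → ℝ) ∈ interior K} := by
    intro x
    rw [closure_subtype]
    have : Subtype.val '' {x : K | (x : ι → ℝ) ∈ interior K} = interior K := by
      ext y
      simp only [Set.mem_image, Set.mem_ofPred_eq, Subtype.exists, exists_and_left, exists_prop]
      exact ⟨fun ⟨z, hz, _, e⟩ => e ▸ hz, fun hy => ⟨y, hy, interior_subset hy, rfl⟩⟩
    rw [this, hK]
    exact x.2
  refine DFunLike.coe_injective (Continuous.ext_on hdense (map_continuous _) (map_continuous _) ?_)
  intro x hx
  rw [hf w x hx, hg w x hx]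
  refine wordDeriv_congr _ ?_
  filter_upwards [isOpen_interior.mem_nhds hx] with y hy using hfg y hy

/-- Evaluation at a point of `K`, as a continuous linear form. -/
def CmSpace.evalCLM (m : ℕ) {K : Set (ι → ℝ)} (x : K) : CmSpace m K →L[ℝ] ℝ where
  toFun f := f.toMap x
  map_add' _ _ := rfl
  map_smul' _ _ := rfl
  cont := by
    have h : Continuous fun F : DerivIndex ι m → C(K, ℝ) => F (zeroIndex ι m) :=
      continuous_apply _
    exact (continuous_eval_const x).comp (h.comp continuous_subtype_val)

@[simp]
theorem CmSpace.evalCLM_apply (m : ℕ) {K : Set (ι → ℝ)} (x : K) (f : CmSpace m K) :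
    CmSpace.evalCLM m x f = f.toMap x := rfl

/-- The inclusion of `C^b(K)` into `C^a(K)`, `a ≤ b`. -/
def CmSpace.incl {a b : ℕ} (hab : a ≤ b) (K : Set (ι → ℝ)) : CmSpace b K →L[ℝ] CmSpace a K where
  toFun f := ⟨fun w => f.1 ⟨⟨w.1, by omega⟩, w.2⟩, by
    obtain ⟨f', h1, h2⟩ := f.2
    exact ⟨f', h1.of_le (by exact_mod_cast hab), fun w x hx => h2 _ x hx⟩⟩
  map_add' _ _ := rfl
  map_smul' _ _ := rfl
  cont := by
    refine Continuous.subtype_mk (continuous_pi fun w => ?_) _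
    have h : Continuous fun F : DerivIndex ι b → C(K, ℝ) => F ⟨⟨w.1, by omega⟩, w.2⟩ :=
      continuous_apply _
    exact h.comp continuous_subtype_val

@[simp]
theorem CmSpace.toMap_incl {a b : ℕ} (hab : a ≤ b) {K : Set (ι → ℝ)} (f : CmSpace b K) :
    (CmSpace.incl hab K f).toMap = f.toMap := rfl

/-- Continuous linear maps can be defined by the values of separating continuous linear forms
(closed graph theorem). -/
theorem exists_clm_of_separating {X E F : Type*} [NormedAddCommGroup E] [NormedSpace ℝ E]
    [CompleteSpace E] [NormedAddCommGroup F] [NormedSpace ℝ F] [CompleteSpace F]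
    (φ : X → E →L[ℝ] ℝ) (ψ : X → F →L[ℝ] ℝ) (hψ : ∀ g g' : F, (∀ x, ψ x g = ψ x g') → g = g')
    (h : ∀ f, ∃ g, ∀ x, ψ x g = φ x f) : ∃ T : E →L[ℝ] F, ∀ f x, ψ x (T f) = φ x f := by
  choose T hT using h
  let L : E →ₗ[ℝ] F :=
    { toFun := T
      map_add' := fun f g => hψ _ _ fun x => by simp [hT]
      map_smul' := fun c f => hψ _ _ fun x => by simp [hT] }
  refine ⟨⟨L, L.continuous_of_seq_closed_graph fun u f g hu hg => hψ _ _ fun x => ?_⟩, hT⟩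
  refine tendsto_nhds_unique (((ψ x).continuous.tendsto _).comp hg) ?_
  have : (ψ x) ∘ (L ∘ u) = (φ x) ∘ u := funext fun n => hT _ _
  rw [this, show ψ x (L f) = φ x f from hT _ _]
  exact ((φ x).continuous.tendsto _).comp hu

end CmSpace

/-! ### Polynomials in `C^m(K)` and their formal derivatives. -/

section Polynomial

open MvPolynomial

variable {ι : Type*}

/-- The iterated partial derivative of a polynomial along a word of coordinates. -/
def wordPderiv : (k : ℕ) → (Fin k → ι) → (MvPolynomial ι ℝ →ₗ[ℝ] MvPolynomial ι ℝ)
  | 0, _ => LinearMap.id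
  | k + 1, w => (pderiv (w 0)).toLinearMap ∘ₗ wordPderiv k (Fin.tail w)

theorem wordPderiv_zero (w : Fin 0 → ι) (p : MvPolynomial ι ℝ) : wordPderiv 0 w p = p := rfl

theorem wordPderiv_succ {k : ℕ} (w : Fin (k + 1) → ι) (p : MvPolynomial ι ℝ) :
    wordPderiv (k + 1) w p = pderiv (w 0) (wordPderiv k (Fin.tail w) p) := rfl

theorem totalDegree_pderiv_le (i : ι) (p : MvPolynomial ι ℝ) :
    (pderiv i p).totalDegree ≤ p.totalDegree := by
  refine Finset.sup_le fun s hs => ?_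
  rw [mem_support_iff, coeff_pderiv] at hs
  have h := le_totalDegree (mem_support_iff.2 (left_ne_zero_of_mul hs))
  refine le_trans ?_ h
  rw [Finsupp.sum_add_index' (fun _ => rfl) (fun _ _ _ => rfl)]
  exact Nat.le_add_right _ _

theorem totalDegree_wordPderiv_le {k : ℕ} (w : Fin k → ι) (p : MvPolynomial ι ℝ) :
    (wordPderiv k w p).totalDegree ≤ p.totalDegree := by
  induction k with
  | zero => exact le_rfl
  | succ k ih => exact (totalDegree_pderiv_le _ _).trans (ih _)

section Derivatives

variable [Fintype ι] [DecidableEq ι]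

theorem contDiff_mvPolynomial_eval (n : WithTop ℕ∞) (p : MvPolynomial ι ℝ) :
    ContDiff ℝ n fun x => eval x p := by
  induction p using MvPolynomial.induction_on with
  | C a => simpa using contDiff_const
  | add p q hp hq => simpa using hp.add hq
  | mul_X p i hp => simpa using hp.mul (contDiff_apply ℝ ℝ i)

theorem fderiv_mvPolynomial_eval (p : MvPolynomial ι ℝ) (i : ι) (x : ι → ℝ) :
    fderiv ℝ (fun x => eval x p) x (Pi.single i 1) = eval x (pderiv i p) := by
  have hd : ∀ p : MvPolynomial ι ℝ, DifferentiableAt ℝ (fun x => eval x p) x := fun p =>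
    ((contDiff_mvPolynomial_eval 1 p).differentiable (by simp)) x
  induction p using MvPolynomial.induction_on with
  | C a => simp
  | add p q hp hq =>
    simp only [map_add]
    rw [fderiv_fun_add (hd p) (hd q), add_apply, hp, hq]
  | mul_X p j hp =>
    simp only [map_mul, eval_X, pderiv_mul, pderiv_X, map_add]
    rw [fderiv_fun_mul (hd p) (differentiableAt_apply j x)]
    rw [(hasFDerivAt_apply j x).fderiv]
    simp only [add_apply, smul_apply, hp, ContinuousLinearMap.proj_apply, smul_eq_mul,
      Pi.single_apply, eq_comm (a := i)]
    split_ifs <;> simp <;> ring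

/-- Turns analytic derivatives into formal ones, so that the Markov inequality can be combined with
the algebra of separated variables. -/
theorem wordDeriv_eval {k : ℕ} (w : Fin k → ι) (p : MvPolynomial ι ℝ) :
    wordDeriv w (fun x => eval x p) = fun x => eval x (wordPderiv k w p) := by
  induction k with
  | zero => exact wordDeriv_zero w _
  | succ k ih =>
    ext x
    rw [wordDeriv_succ w (contDiff_mvPolynomial_eval _ p).contDiffAt, ih,
      fderiv_mvPolynomial_eval, wordPderiv_succ]

/-- A polynomial as an element of `C^m(K)`. -/
def polyCm (m : ℕ) (K : Set (ι → ℝ)) : MvPolynomial ι ℝ →ₗ[ℝ] CmSpace m K where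
  toFun p := ⟨fun w => ⟨fun x => eval (x : ι → ℝ) (wordPderiv w.1 w.2 p),
      (continuous_eval _).comp continuous_subtype_val⟩,
    fun x => eval x p, (contDiff_mvPolynomial_eval _ p).contDiffOn,
    fun w x _ => (congrFun (wordDeriv_eval w.2 p) x).symm⟩
  map_add' p q := by
    refine Subtype.ext (funext fun w => ContinuousMap.ext fun x => ?_)
    simp
  map_smul' c p := by
    refine Subtype.ext (funext fun w => ContinuousMap.ext fun x => ?_)
    simp [smul_eval]

@[simp]
theorem toMap_polyCm (m : ℕ) {K : Set (ι → ℝ)} (p : MvPolynomial ι ℝ) (x : K) :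
    (polyCm m K p).toMap x = eval (x : ι → ℝ) p := rfl

theorem incl_polyCm {a b : ℕ} (hab : a ≤ b) {K : Set (ι → ℝ)} (p : MvPolynomial ι ℝ) :
    CmSpace.incl hab K (polyCm b K p) = polyCm a K p := rfl

theorem norm_polyCm_le {m : ℕ} {K : Set (ι → ℝ)} [CompactSpace K] {p : MvPolynomial ι ℝ} {c : ℝ}
    (hc : 0 ≤ c) (h : ∀ k ≤ m, ∀ (w : Fin k → ι) (x : K),
      |eval (x : ι → ℝ) (wordPderiv k w p)| ≤ c) : ‖polyCm m K p‖ ≤ c := by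
  rw [Submodule.coe_norm, pi_norm_le_iff_of_nonneg hc]
  intro w
  rw [ContinuousMap.norm_le _ hc]
  exact fun x => h w.1 (by omega) w.2 x

theorem abs_eval_wordPderiv_le_norm {m : ℕ} {K : Set (ι → ℝ)} [CompactSpace K]
    (p : MvPolynomial ι ℝ) {k : ℕ} (hk : k ≤ m) (w : Fin k → ι) (x : K) :
    |eval (x : ι → ℝ) (wordPderiv k w p)| ≤ ‖polyCm m K p‖ :=
  ((polyCm m K p).1 ⟨⟨k, by omega⟩, w⟩).norm_coe_le_norm x |>.trans
    (norm_le_pi_norm (polyCm m K p).1 ⟨⟨k, by omega⟩, w⟩)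

theorem polyCm_mem {m d : ℕ} {K : Set (ι → ℝ)} {p : MvPolynomial ι ℝ} (hp : p.totalDegree ≤ d) :
    polyCm m K p ∈ polySubmodule m K d :=
  ⟨p, hp, fun _ => rfl⟩

theorem exists_polyCm_eq {m d : ℕ} {K : Set (ι → ℝ)} (hK : closure (interior K) = K)
    {f : CmSpace m K} (hf : f ∈ polySubmodule m K d) :
    ∃ p : MvPolynomial ι ℝ, p.totalDegree ≤ d ∧ f = polyCm m K p := by
  obtain ⟨p, hp, hfp⟩ := hf
  exact ⟨p, hp, CmSpace.ext_toMap hK hfp⟩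

end Derivatives

/-! ### Polynomials in two groups of variables: products, sections, partial application. -/

section Products

variable {ι₁ ι₂ : Type*}

/-- The product `u(x) v(y)` of polynomials in separate variables. -/
def mulPoly (u : MvPolynomial ι₁ ℝ) (v : MvPolynomial ι₂ ℝ) : MvPolynomial (ι₁ ⊕ ι₂) ℝ :=
  rename Sum.inl u * rename Sum.inr v

theorem totalDegree_mulPoly_le (u : MvPolynomial ι₁ ℝ) (v : MvPolynomial ι₂ ℝ) :
    (mulPoly u v).totalDegree ≤ u.totalDegree + v.totalDegree :=
  (totalDegree_mul _ _).trans
    (add_le_add (totalDegree_rename_le _ _) (totalDegree_rename_le _ _))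

theorem eval_mulPoly (u : MvPolynomial ι₁ ℝ) (v : MvPolynomial ι₂ ℝ) (z : ι₁ ⊕ ι₂ → ℝ) :
    eval z (mulPoly u v) = eval (fun i => z (Sum.inl i)) u * eval (fun j => z (Sum.inr j)) v := by
  simp only [mulPoly, map_mul, eval_rename]
  rfl

theorem mulPoly_monomial (a : ι₁ →₀ ℕ) (b : ι₂ →₀ ℕ) (c e : ℝ) :
    mulPoly (monomial a c) (monomial b e) =
      monomial (Finsupp.sumFinsuppEquivProdFinsupp.symm (a, b)) (c * e) := by
  rw [mulPoly, rename_monomial, rename_monomial, monomial_mul]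
  refine congrArg (fun s => monomial s (c * e)) ?_
  refine Finsupp.ext ?_
  rintro (i | j)
  · rw [Finsupp.add_apply, Finsupp.mapDomain_apply Sum.inl_injective,
      Finsupp.mapDomain_of_notMem_range _ _ (by simp), Finsupp.sumFinsuppEquivProdFinsupp_symm_inl,
      add_zero]
  · rw [Finsupp.add_apply, Finsupp.mapDomain_apply Sum.inr_injective,
      Finsupp.mapDomain_of_notMem_range _ _ (by simp), Finsupp.sumFinsuppEquivProdFinsupp_symm_inr,
      zero_add]

theorem monomial_eq_mulPoly (s : ι₁ ⊕ ι₂ →₀ ℕ) (c : ℝ) :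
    monomial s c = c • mulPoly (monomial (Finsupp.sumFinsuppEquivProdFinsupp s).1 1)
      (monomial (Finsupp.sumFinsuppEquivProdFinsupp s).2 1) := by
  rw [mulPoly_monomial, smul_monomial, Prod.mk.eta, Equiv.symm_apply_apply]
  simp

/-- Each monomial is a product of monomials in the two groups, with degrees adding up exactly. Facts
about degree at most `d` thus reduce to products of bidegree `i + j ≤ d`. -/
theorem mem_span_mulPoly {d : ℕ} {h : MvPolynomial (ι₁ ⊕ ι₂) ℝ} (hd : h.totalDegree ≤ d) :
    h ∈ Submodule.span ℝ {p | ∃ (u : MvPolynomial ι₁ ℝ) (v : MvPolynomial ι₂ ℝ),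
      u.totalDegree + v.totalDegree ≤ d ∧ p = mulPoly u v} := by
  rw [h.as_sum]
  refine Submodule.sum_mem _ fun s hs => ?_
  rw [monomial_eq_mulPoly]
  refine Submodule.smul_mem _ _ (Submodule.subset_span ⟨_, _, ?_, rfl⟩)
  rw [totalDegree_monomial _ one_ne_zero, totalDegree_monomial _ one_ne_zero]
  refine le_trans (le_of_eq ?_) ((le_totalDegree hs).trans hd)
  -- Additivity of the degree is read off by comparing total degrees in the factorisation of the
  -- monic monomial.
  have h := congrArg totalDegree (monomial_eq_mulPoly s 1)
  rw [one_smul, mulPoly, rename_monomial, rename_monomial, monomial_mul, mul_one,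
    totalDegree_monomial _ one_ne_zero, totalDegree_monomial _ one_ne_zero,
    Finsupp.sum_add_index' (fun _ => rfl) (fun _ _ _ => rfl),
    Finsupp.sum_mapDomain_index (fun _ => rfl) (fun _ _ _ => rfl),
    Finsupp.sum_mapDomain_index (fun _ => rfl) (fun _ _ _ => rfl)] at h
  exact h.symm

theorem linearMap_ext_mulPoly {M : Type*} [AddCommMonoid M] [Module ℝ M]
    {L L' : MvPolynomial (ι₁ ⊕ ι₂) ℝ →ₗ[ℝ] M} (h : ∀ u v, L (mulPoly u v) = L' (mulPoly u v)) :
    L = L' := by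
  refine LinearMap.ext fun p => ?_
  rw [p.as_sum, map_sum, map_sum]
  refine Finset.sum_congr rfl fun s _ => ?_
  rw [monomial_eq_mulPoly, map_smul, map_smul, h]

theorem pderiv_inl_mulPoly (i : ι₁) (u : MvPolynomial ι₁ ℝ) (v : MvPolynomial ι₂ ℝ) :
    pderiv (Sum.inl i) (mulPoly u v) = mulPoly (pderiv i u) v := by
  have h : pderiv (Sum.inl i : ι₁ ⊕ ι₂) (rename Sum.inr v) = 0 := by
    classical
    refine pderiv_eq_zero_of_notMem_vars fun hi => ?_
    have := vars_rename _ _ hi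
    simp at this
  rw [mulPoly, pderiv_mul, h, pderiv_rename Sum.inl_injective, mul_zero, add_zero, mulPoly]

theorem pderiv_inr_mulPoly (j : ι₂) (u : MvPolynomial ι₁ ℝ) (v : MvPolynomial ι₂ ℝ) :
    pderiv (Sum.inr j) (mulPoly u v) = mulPoly u (pderiv j v) := by
  have h : pderiv (Sum.inr j : ι₁ ⊕ ι₂) (rename Sum.inl u) = 0 := by
    classical
    refine pderiv_eq_zero_of_notMem_vars fun hi => ?_
    have := vars_rename _ _ hi
    simp at this
  rw [mulPoly, pderiv_mul, h, pderiv_rename Sum.inr_injective, zero_mul, zero_add, mulPoly]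

/-- Apply a linear form to a polynomial in the second group of variables. -/
def partialApply (φ : MvPolynomial ι₂ ℝ →ₗ[ℝ] ℝ) :
    MvPolynomial (ι₁ ⊕ ι₂) ℝ →ₗ[ℝ] MvPolynomial ι₁ ℝ :=
  (basisMonomials (ι₁ ⊕ ι₂) ℝ).constr ℝ fun s =>
    φ (monomial (Finsupp.sumFinsuppEquivProdFinsupp s).2 1) •
      monomial (Finsupp.sumFinsuppEquivProdFinsupp s).1 1

theorem partialApply_mulPoly (φ : MvPolynomial ι₂ ℝ →ₗ[ℝ] ℝ) (u : MvPolynomial ι₁ ℝ)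
    (v : MvPolynomial ι₂ ℝ) : partialApply φ (mulPoly u v) = φ v • u := by
  have hu : ∀ u u' : MvPolynomial ι₁ ℝ, mulPoly (u + u') v = mulPoly u v + mulPoly u' v :=
    fun u u' => by simp [mulPoly, add_mul]
  induction u using MvPolynomial.induction_on' with
  | add u u' h h' => rw [hu, map_add, h, h', smul_add]
  | monomial a c =>
    have hv : ∀ v v' : MvPolynomial ι₂ ℝ, mulPoly (monomial a c) (v + v') =
        mulPoly (monomial a c) v + mulPoly (monomial a c) v' :=
      fun v v' => by simp [mulPoly, mul_add]
    clear hu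
    induction v using MvPolynomial.induction_on' with
    | add v v' h h' => rw [hv, map_add, h, h', map_add, add_smul]
    | monomial b e =>
      have h1 : ∀ s : ι₁ ⊕ ι₂ →₀ ℕ, monomial s (c * e) = (c * e) • basisMonomials (ι₁ ⊕ ι₂) ℝ s :=
        fun s => by simp [smul_monomial]
      have h2 : (monomial b e : MvPolynomial ι₂ ℝ) = e • monomial b 1 := by simp [smul_monomial]
      rw [mulPoly_monomial, h1, map_smul, partialApply, Module.Basis.constr_basis,
        Equiv.apply_symm_apply, h2, map_smul]
      simp only [smul_monomial, smul_eq_mul]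
      congr 1
      ring

/-- Fix the first group of variables. -/
def sectionRight (x : ι₁ → ℝ) : MvPolynomial (ι₁ ⊕ ι₂) ℝ →ₐ[ℝ] MvPolynomial ι₂ ℝ :=
  aeval (Sum.elim (fun i => C (x i)) X)

/-- Fix the second group of variables. -/
def sectionLeft (y : ι₂ → ℝ) : MvPolynomial (ι₁ ⊕ ι₂) ℝ →ₐ[ℝ] MvPolynomial ι₁ ℝ :=
  aeval (Sum.elim X (fun j => C (y j)))

theorem sectionRight_mulPoly (x : ι₁ → ℝ) (u : MvPolynomial ι₁ ℝ) (v : MvPolynomial ι₂ ℝ) :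
    sectionRight x (mulPoly u v) = eval x u • v := by
  rw [sectionRight, mulPoly, map_mul, aeval_rename, aeval_rename, Sum.elim_comp_inr, aeval_X_left,
    AlgHom.id_apply, Sum.elim_comp_inl, smul_eq_C_mul]
  congr 1
  exact (aeval_algebraMap_apply (MvPolynomial ι₂ ℝ) x u).trans (by simp [aeval_eq_eval])

theorem sectionLeft_mulPoly (y : ι₂ → ℝ) (u : MvPolynomial ι₁ ℝ) (v : MvPolynomial ι₂ ℝ) :
    sectionLeft y (mulPoly u v) = eval y v • u := by
  rw [sectionLeft, mulPoly, map_mul, aeval_rename, aeval_rename, Sum.elim_comp_inl, aeval_X_left,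
    AlgHom.id_apply, Sum.elim_comp_inr, smul_eq_C_mul, mul_comm]
  congr 1
  exact (aeval_algebraMap_apply (MvPolynomial ι₁ ℝ) y v).trans (by simp [aeval_eq_eval])

theorem eval_sectionRight (x : ι₁ → ℝ) (y : ι₂ → ℝ) (h : MvPolynomial (ι₁ ⊕ ι₂) ℝ) :
    eval y (sectionRight x h) = eval (Sum.elim x y) h := by
  have : (aeval y).toLinearMap ∘ₗ (sectionRight x).toLinearMap =
      (aeval (Sum.elim x y)).toLinearMap :=
    linearMap_ext_mulPoly fun u v => by
      simp [sectionRight_mulPoly, aeval_eq_eval, eval_mulPoly, mul_comm]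
  simpa [aeval_eq_eval] using LinearMap.congr_fun this h

theorem eval_sectionLeft (x : ι₁ → ℝ) (y : ι₂ → ℝ) (h : MvPolynomial (ι₁ ⊕ ι₂) ℝ) :
    eval x (sectionLeft y h) = eval (Sum.elim x y) h := by
  have : (aeval x).toLinearMap ∘ₗ (sectionLeft y).toLinearMap =
      (aeval (Sum.elim x y)).toLinearMap :=
    linearMap_ext_mulPoly fun u v => by
      simp [sectionLeft_mulPoly, aeval_eq_eval, eval_mulPoly, mul_comm]
  simpa [aeval_eq_eval] using LinearMap.congr_fun this h

theorem totalDegree_sectionRight_le (x : ι₁ → ℝ) (h : MvPolynomial (ι₁ ⊕ ι₂) ℝ) :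
    (sectionRight x h).totalDegree ≤ h.totalDegree := by
  have := mem_span_mulPoly (le_refl h.totalDegree)
  have H : Submodule.span ℝ {p | ∃ (u : MvPolynomial ι₁ ℝ) (v : MvPolynomial ι₂ ℝ),
      u.totalDegree + v.totalDegree ≤ h.totalDegree ∧ p = mulPoly u v} ≤
      (restrictTotalDegree ι₂ ℝ h.totalDegree).comap (sectionRight x).toLinearMap := by
    rw [Submodule.span_le]
    rintro _ ⟨u, v, huv, rfl⟩
    rw [SetLike.mem_coe, Submodule.mem_comap, mem_restrictTotalDegree, AlgHom.toLinearMap_apply,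
      sectionRight_mulPoly]
    exact (totalDegree_smul_le _ _).trans (by omega)
  exact (mem_restrictTotalDegree _ _ _).1 (H this)

theorem totalDegree_sectionLeft_le (y : ι₂ → ℝ) (h : MvPolynomial (ι₁ ⊕ ι₂) ℝ) :
    (sectionLeft y h).totalDegree ≤ h.totalDegree := by
  have := mem_span_mulPoly (le_refl h.totalDegree)
  have H : Submodule.span ℝ {p | ∃ (u : MvPolynomial ι₁ ℝ) (v : MvPolynomial ι₂ ℝ),
      u.totalDegree + v.totalDegree ≤ h.totalDegree ∧ p = mulPoly u v} ≤
      (restrictTotalDegree ι₁ ℝ h.totalDegree).comap (sectionLeft y).toLinearMap := by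
    rw [Submodule.span_le]
    rintro _ ⟨u, v, huv, rfl⟩
    rw [SetLike.mem_coe, Submodule.mem_comap, mem_restrictTotalDegree, AlgHom.toLinearMap_apply,
      sectionLeft_mulPoly]
    exact (totalDegree_smul_le _ _).trans (by omega)
  exact (mem_restrictTotalDegree _ _ _).1 (H this)

theorem eval_partialApply (φ : MvPolynomial ι₂ ℝ →ₗ[ℝ] ℝ) (x : ι₁ → ℝ)
    (h : MvPolynomial (ι₁ ⊕ ι₂) ℝ) : eval x (partialApply φ h) = φ (sectionRight x h) := by
  have : (aeval x).toLinearMap ∘ₗ partialApply φ = φ ∘ₗ (sectionRight x).toLinearMap :=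
    linearMap_ext_mulPoly fun u v => by
      simp [partialApply_mulPoly, sectionRight_mulPoly, aeval_eq_eval, mul_comm]
  simpa [aeval_eq_eval] using LinearMap.congr_fun this h

theorem wordPderiv_sectionRight (x : ι₁ → ℝ) {k : ℕ} (w : Fin k → ι₂)
    (h : MvPolynomial (ι₁ ⊕ ι₂) ℝ) :
    wordPderiv k w (sectionRight x h) = sectionRight x (wordPderiv k (Sum.inr ∘ w) h) := by
  have hp : ∀ (j : ι₂) (g : MvPolynomial (ι₁ ⊕ ι₂) ℝ),
      pderiv j (sectionRight x g) = sectionRight x (pderiv (Sum.inr j) g) := by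
    intro j g
    have : (pderiv j).toLinearMap ∘ₗ (sectionRight x).toLinearMap =
        (sectionRight x).toLinearMap ∘ₗ (pderiv (Sum.inr j : ι₁ ⊕ ι₂)).toLinearMap :=
      linearMap_ext_mulPoly fun u v => by
        simp [pderiv_inr_mulPoly, sectionRight_mulPoly]
    exact LinearMap.congr_fun this g
  induction k with
  | zero => rfl
  | succ k ih => rw [wordPderiv_succ, ih, hp]; rfl

theorem wordPderiv_sectionLeft (y : ι₂ → ℝ) {k : ℕ} (w : Fin k → ι₁)
    (h : MvPolynomial (ι₁ ⊕ ι₂) ℝ) :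
    wordPderiv k w (sectionLeft y h) = sectionLeft y (wordPderiv k (Sum.inl ∘ w) h) := by
  have hp : ∀ (j : ι₁) (g : MvPolynomial (ι₁ ⊕ ι₂) ℝ),
      pderiv j (sectionLeft y g) = sectionLeft y (pderiv (Sum.inl j) g) := by
    intro j g
    have : (pderiv j).toLinearMap ∘ₗ (sectionLeft y).toLinearMap =
        (sectionLeft y).toLinearMap ∘ₗ (pderiv (Sum.inl j : ι₁ ⊕ ι₂)).toLinearMap :=
      linearMap_ext_mulPoly fun u v => by
        simp [pderiv_inl_mulPoly, sectionLeft_mulPoly]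
    exact LinearMap.congr_fun this g
  induction k with
  | zero => rfl
  | succ k ih => rw [wordPderiv_succ, ih, hp]; rfl

/-- Differentiation in the first group passes under a linear form acting on the second; this is what
makes the partial application controllable in a `C^m` norm. -/
theorem wordPderiv_partialApply (φ : MvPolynomial ι₂ ℝ →ₗ[ℝ] ℝ) {k : ℕ} (w : Fin k → ι₁)
    (h : MvPolynomial (ι₁ ⊕ ι₂) ℝ) :
    wordPderiv k w (partialApply φ h) = partialApply φ (wordPderiv k (Sum.inl ∘ w) h) := by
  have hp : ∀ j (g : MvPolynomial (ι₁ ⊕ ι₂) ℝ),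
      pderiv j (partialApply φ g) = partialApply φ (pderiv (Sum.inl j) g) := by
    intro j g
    have : (pderiv j).toLinearMap ∘ₗ partialApply φ =
        partialApply φ ∘ₗ (pderiv (Sum.inl j : ι₁ ⊕ ι₂)).toLinearMap :=
      linearMap_ext_mulPoly fun u v => by
        simp [pderiv_inl_mulPoly, partialApply_mulPoly]
    exact LinearMap.congr_fun this g
  induction k with
  | zero => rfl
  | succ k ih => rw [wordPderiv_succ, ih, hp]; rfl

end Products

end Polynomial

/-! ### Sup norms. -/

section SupNorm

variable {ι : Type*} [Fintype ι]

theorem abs_le_supNormOn {K : Set (ι → ℝ)} [CompactSpace K] (g : C(K, ℝ)) (x : K) :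
    |g x| ≤ supNormOn K g :=
  le_ciSup (f := fun x => |g x|) ⟨‖g‖, by rintro _ ⟨y, rfl⟩; exact g.norm_coe_le_norm y⟩ x

theorem supNormOn_le {X : Type*} {K : Set X} (hK : K.Nonempty) {g : K → ℝ} {c : ℝ}
    (h : ∀ x, |g x| ≤ c) : supNormOn K g ≤ c :=
  have := hK.to_subtype
  ciSup_le h

end SupNorm

/-! ### Consequences of the Markov inequality. -/

section Markov

open MvPolynomial

variable {ι : Type*} [Fintype ι] [DecidableEq ι]

/-- The restriction of a polynomial to `K`. -/
def polyMap (K : Set (ι → ℝ)) (p : MvPolynomial ι ℝ) : C(K, ℝ) :=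
  ⟨fun x => eval (x : ι → ℝ) p, (continuous_eval _).comp continuous_subtype_val⟩

theorem SatisfiesMarkov.exists_abs_le {K : Set (ι → ℝ)} [CompactSpace K] {r : ℝ}
    (h : SatisfiesMarkov K r) : ∃ B : ℝ, 0 < B ∧ ∀ (p : MvPolynomial ι ℝ) (c : ℝ),
      (∀ x ∈ K, |eval x p| ≤ c) → ∀ (k : ℕ) (w : Fin k → ι), ∀ x ∈ K,
        |eval x (wordPderiv k w p)| ≤ B * (p.totalDegree : ℝ) ^ (r * k) * c := by
  obtain ⟨B, hB, hM⟩ := h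
  refine ⟨B, hB, fun p c hc k w x hx => ?_⟩
  have h1 := hM p k w
  rw [wordDeriv_eval] at h1
  refine (abs_le_supNormOn (polyMap K (wordPderiv k w p)) ⟨x, hx⟩).trans (h1.trans ?_)
  gcongr
  exact supNormOn_le ⟨x, hx⟩ fun y => hc y y.2

/-- High powers of a shifted coordinate, positive on `K`, refute a negative exponent: at a maximum
point of the coordinate the derivative of the `(d+1)`-st power exceeds the sup norm by a factor
proportional to `d + 1`, while the Markov factor stays bounded. -/
theorem SatisfiesMarkov.exponent_nonneg [Nonempty ι] {K : Set (ι → ℝ)} [CompactSpace K] {r : ℝ}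
    (h : SatisfiesMarkov K r) (hK : K.Nonempty) : 0 ≤ r := by
  by_contra! hr
  obtain ⟨B, hB, hM⟩ := h.exists_abs_le
  let i : ι := Classical.arbitrary ι
  obtain ⟨R, hR⟩ : ∃ R, ∀ x ∈ K, |x i| ≤ R := by
    have hKc : IsCompact K := isCompact_iff_compactSpace.2 ‹_›
    obtain ⟨R, hR⟩ := hKc.exists_bound_of_continuousOn (f := fun x => x i)
      (continuous_apply i).continuousOn
    exact ⟨R, hR⟩
  have hKc : IsCompact K := isCompact_iff_compactSpace.2 ‹_›
  obtain ⟨z, hz, hmax⟩ := hKc.exists_isMaxOn hK (f := fun x => x i) (continuous_apply i).continuousOn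
  -- The shift by `R + 1` makes the linear form at least `1` on `K`; `S` is its maximum.
  set S := z i + (R + 1) with hS
  have hz1 := abs_le.1 (hR z hz)
  have hS1 : 1 ≤ S := by linarith
  obtain ⟨d, hd⟩ := exists_nat_gt (B * S)
  let p : MvPolynomial ι ℝ := (X i + C (R + 1)) ^ (d + 1)
  have hp : ∀ x, eval x p = (x i + (R + 1)) ^ (d + 1) := fun x => by simp [p]
  have hb : ∀ x ∈ K, |eval x p| ≤ S ^ (d + 1) := by
    intro x hx
    have h1 := abs_le.1 (hR x hx)
    have h2 : x i ≤ z i := hmax hx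
    rw [hp, abs_of_nonneg (by apply pow_nonneg; linarith)]
    exact pow_le_pow_left₀ (by linarith) (by linarith) _
  have h1 := hM p _ hb 1 (fun _ => i) z hz
  have h2 : eval z (wordPderiv 1 (fun _ => i) p) = (d + 1) * S ^ d := by
    rw [wordPderiv_succ, wordPderiv_zero]
    simp [p, hS]
  have hdeg : ((p.totalDegree : ℝ)) ^ (r * (1 : ℕ)) ≤ 1 := by
    rw [Nat.cast_one, mul_one]
    -- The degree of `p` need not be computed; in degree zero the convention `0 ^ r = 0` for `r ≠ 0`
    -- gives the bound.
    rcases Nat.eq_zero_or_pos p.totalDegree with h0 | h0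
    · rw [h0, Nat.cast_zero, Real.zero_rpow hr.ne]
      exact zero_le_one
    · exact Real.rpow_le_one_of_one_le_of_nonpos (by exact_mod_cast h0) hr.le
  rw [h2, abs_of_nonneg (by positivity)] at h1
  have hSd : 0 < S ^ d := by positivity
  have h3 : (d + 1) * S ^ d ≤ (B * S) * S ^ d := by
    refine h1.trans ?_
    calc B * (p.totalDegree : ℝ) ^ (r * (1 : ℕ)) * S ^ (d + 1) ≤ B * 1 * S ^ (d + 1) := by gcongr
      _ = (B * S) * S ^ d := by ring
  have h4 := le_of_mul_le_mul_right h3 hSd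
  linarith

variable {ι₁ ι₂ : Type*} [Fintype ι₁] [DecidableEq ι₁] [Fintype ι₂] [DecidableEq ι₂]

/-- All mixed partial derivatives of order at most `m` in each group of variables are bounded by
`c` on `K₁ × K₂`. -/
def MixedBound (m : ℕ) (K₁ : Set (ι₁ → ℝ)) (K₂ : Set (ι₂ → ℝ))
    (h : MvPolynomial (ι₁ ⊕ ι₂) ℝ) (c : ℝ) : Prop :=
  ∀ k₁ ≤ m, ∀ k₂ ≤ m, ∀ (w₁ : Fin k₁ → ι₁) (w₂ : Fin k₂ → ι₂), ∀ x ∈ K₁, ∀ y ∈ K₂,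
    |eval (Sum.elim x y) (wordPderiv k₂ (Sum.inr ∘ w₂) (wordPderiv k₁ (Sum.inl ∘ w₁) h))| ≤ c

variable {K₁ : Set (ι₁ → ℝ)} {K₂ : Set (ι₂ → ℝ)} [CompactSpace K₁] [CompactSpace K₂]

theorem MixedBound.norm_sectionRight_le {m : ℕ} {h : MvPolynomial (ι₁ ⊕ ι₂) ℝ} {c : ℝ}
    (hb : MixedBound m K₁ K₂ h c) (hc : 0 ≤ c) {k : ℕ} (hk : k ≤ m) (w : Fin k → ι₁) {x : ι₁ → ℝ}
    (hx : x ∈ K₁) : ‖polyCm m K₂ (sectionRight x (wordPderiv k (Sum.inl ∘ w) h))‖ ≤ c := by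
  refine norm_polyCm_le hc fun k₂ hk₂ w₂ y => ?_
  rw [wordPderiv_sectionRight, eval_sectionRight]
  exact hb k hk k₂ hk₂ w w₂ x hx y y.2

/-- This is why mixed derivatives are the right control: up to `m` derivatives in `x` are taken
outside the form, and the form itself costs up to `m` derivatives in `y`. -/
theorem MixedBound.norm_partialApply_le {m : ℕ} {h : MvPolynomial (ι₁ ⊕ ι₂) ℝ} {c : ℝ}
    (hb : MixedBound m K₁ K₂ h c) (hc : 0 ≤ c) {φ : MvPolynomial ι₂ ℝ →ₗ[ℝ] ℝ} {A : ℝ} (hA : 0 ≤ A)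
    (hφ : ∀ v, |φ v| ≤ A * ‖polyCm m K₂ v‖) : ‖polyCm m K₁ (partialApply φ h)‖ ≤ A * c := by
  refine norm_polyCm_le (by positivity) fun k hk w x => ?_
  rw [wordPderiv_partialApply, eval_partialApply]
  exact (hφ _).trans (mul_le_mul_of_nonneg_left (hb.norm_sectionRight_le hc hk w x.2) hA)

/-- Markov is applied on `K₁` with `y` frozen, then on `K₂` with `x` frozen, so the exponents add.
Their nonnegativity allows the degree and the order to be replaced by the upper bounds `n ≥ 1` and
`m`. -/
theorem exists_mixedBound_of_markov {r₁ r₂ : ℝ} (h₁ : SatisfiesMarkov K₁ r₁)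
    (h₂ : SatisfiesMarkov K₂ r₂) (hr₁ : 0 ≤ r₁) (hr₂ : 0 ≤ r₂) (m : ℕ) :
    ∃ B : ℝ, 0 < B ∧ ∀ (n : ℕ), 1 ≤ n → ∀ (h : MvPolynomial (ι₁ ⊕ ι₂) ℝ), h.totalDegree ≤ n →
      ∀ c, 0 ≤ c → (∀ z ∈ prodSet K₁ K₂, |eval z h| ≤ c) →
        MixedBound m K₁ K₂ h (B * (n : ℝ) ^ ((m : ℝ) * (r₁ + r₂)) * c) := by
  obtain ⟨B₁, hB₁, H₁⟩ := h₁.exists_abs_le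
  obtain ⟨B₂, hB₂, H₂⟩ := h₂.exists_abs_le
  refine ⟨B₂ * B₁, by positivity, fun n hn h hh c hc hz k₁ hk₁ k₂ hk₂ w₁ w₂ x hx y hy => ?_⟩
  have hn' : (1 : ℝ) ≤ n := by exact_mod_cast hn
  have hpow : ∀ (d k : ℕ) (r : ℝ), d ≤ n → k ≤ m → 0 ≤ r →
      (d : ℝ) ^ (r * k) ≤ (n : ℝ) ^ ((m : ℝ) * r) := by
    intro d k r hd hk hr
    calc (d : ℝ) ^ (r * k) ≤ (n : ℝ) ^ (r * k) :=
          Real.rpow_le_rpow (by positivity) (by exact_mod_cast hd) (by positivity)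
      _ ≤ (n : ℝ) ^ ((m : ℝ) * r) := by
          refine Real.rpow_le_rpow_of_exponent_le hn' ?_
          rw [mul_comm]
          gcongr
  have e₁ : ∀ y' ∈ K₂, |eval (Sum.elim x y') (wordPderiv k₁ (Sum.inl ∘ w₁) h)| ≤
      B₁ * (n : ℝ) ^ ((m : ℝ) * r₁) * c := by
    intro y' hy'
    have := H₁ (sectionLeft y' h) c (fun x' hx' => by
      rw [eval_sectionLeft]; exact hz _ ⟨hx', hy'⟩) k₁ w₁ x hx
    rw [wordPderiv_sectionLeft, eval_sectionLeft] at this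
    refine this.trans ?_
    gcongr
    exact hpow _ _ _ ((totalDegree_sectionLeft_le _ _).trans hh) hk₁ hr₁
  have := H₂ (sectionRight x (wordPderiv k₁ (Sum.inl ∘ w₁) h)) _ (fun y' hy' => by
      rw [eval_sectionRight]; exact e₁ y' hy') k₂ w₂ y hy
  rw [wordPderiv_sectionRight, eval_sectionRight] at this
  refine this.trans ?_
  calc _ ≤ B₂ * (n : ℝ) ^ ((m : ℝ) * r₂) * (B₁ * (n : ℝ) ^ ((m : ℝ) * r₁) * c) := by
        gcongr
        exact hpow _ _ _ ((totalDegree_sectionRight_le _ _).trans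
          ((totalDegree_wordPderiv_le _ _).trans hh)) hk₂ hr₂
    _ = B₂ * B₁ * (n : ℝ) ^ ((m : ℝ) * (r₁ + r₂)) * c := by
        rw [mul_add, Real.rpow_add (by linarith)]
        ring

end Markov

/-! ### Dyadic polynomial approximation on the product. -/

section Jackson

open MvPolynomial

variable {ι : Type*} [Fintype ι] [DecidableEq ι]

theorem IsJackson.exists_approx {K : Set (ι → ℝ)} [CompactSpace K] (hJ : IsJackson K) {m : ℕ}
    (f : CmSpace m K) : ∃ A : ℝ, 0 < A ∧ ∀ d : ℕ, 1 ≤ d → ∃ p : MvPolynomial ι ℝ,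
      p.totalDegree ≤ d ∧ ∀ x : K, |f.toMap x - eval (x : ι → ℝ) p| ≤ A / (d : ℝ) ^ m := by
  obtain ⟨A, hA⟩ := hJ m f
  -- The infimum is not known to be attained, so the constant is strictly enlarged to extract an
  -- approximant.
  refine ⟨|A| + 1, by positivity, fun d hd => ?_⟩
  have hd' : (0 : ℝ) < (d : ℝ) ^ m := by
    have : (0 : ℝ) < d := by exact_mod_cast hd
    positivity
  have : Nonempty {p : MvPolynomial ι ℝ // p.totalDegree ≤ d} := ⟨⟨0, by simp⟩⟩
  have hlt : A / (d : ℝ) ^ m < (|A| + 1) / (d : ℝ) ^ m := by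
    gcongr
    linarith [le_abs_self A]
  obtain ⟨p, hp⟩ := exists_lt_of_ciInf_lt ((hA d hd).trans_lt hlt)
  exact ⟨p.1, p.2, fun x => (abs_le_supNormOn (f.toMap - polyMap K p.1) x).trans hp.le⟩

variable {ι₁ ι₂ : Type*} [Fintype ι₁] [DecidableEq ι₁] [Fintype ι₂] [DecidableEq ι₂]

/-- `P` is a sequence of polynomials of degree at most `2 ^ l` converging to `f` at a geometric
rate `τ`, in the uniform norm and in the norm given by the mixed derivatives of order at most `m`
in each group of variables. -/
structure IsGeomApprox (m : ℕ) {b : ℕ} {K₁ : Set (ι₁ → ℝ)} {K₂ : Set (ι₂ → ℝ)} (τ A : ℝ)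
    (f : CmSpace b (prodSet K₁ K₂)) (P : ℕ → MvPolynomial (ι₁ ⊕ ι₂) ℝ) : Prop where
  totalDegree_le : ∀ l, (P l).totalDegree ≤ 2 ^ l
  mixedBound : ∀ l, MixedBound m K₁ K₂ (P (l + 1) - P l) (A * τ ^ l)
  abs_sub_le : ∀ l, ∀ z : prodSet K₁ K₂, |f.toMap z - eval (z : ι₁ ⊕ ι₂ → ℝ) (P l)| ≤ A * τ ^ l

/-- Jackson at degree `2^l` gives `2^{-lb}`, and Markov costs `2^{(l+1)s}` on the increments, `s =
m(r₁+r₂)`. The ratio `τ = 2^{s-b}` does not depend on `f` and is below `1/2` because `b > 1 + s`. -/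
theorem exists_isGeomApprox {K₁ : Set (ι₁ → ℝ)} {K₂ : Set (ι₂ → ℝ)} [CompactSpace K₁]
    [CompactSpace K₂] [CompactSpace (prodSet K₁ K₂)] (hJ : IsJackson (prodSet K₁ K₂)) {r₁ r₂ : ℝ}
    (h₁ : SatisfiesMarkov K₁ r₁) (h₂ : SatisfiesMarkov K₂ r₂) (hr₁ : 0 ≤ r₁) (hr₂ : 0 ≤ r₂)
    {m b : ℕ} (hb : 1 + (m : ℝ) * (r₁ + r₂) < b) :
    ∃ τ : ℝ, 0 ≤ τ ∧ τ < 1 / 2 ∧ ∀ f : CmSpace b (prodSet K₁ K₂), ∃ A : ℝ, 0 ≤ A ∧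
      ∃ P, IsGeomApprox m τ A f P := by
  obtain ⟨B, hB, H⟩ := exists_mixedBound_of_markov h₁ h₂ hr₁ hr₂ m
  set s : ℝ := (m : ℝ) * (r₁ + r₂) with hs
  have hs0 : 0 ≤ s := by positivity
  refine ⟨(2 : ℝ) ^ (s - b), by positivity, ?_, fun f => ?_⟩
  · have : (2 : ℝ) ^ (s - b) < 2 ^ (-1 : ℝ) := Real.rpow_lt_rpow_of_exponent_lt one_lt_two (by linarith)
    rwa [Real.rpow_neg_one, ← one_div] at this
  obtain ⟨A, hA, hP⟩ := hJ.exists_approx f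
  choose P hdeg hPf using fun l : ℕ => hP (2 ^ l) Nat.one_le_two_pow
  set τ : ℝ := (2 : ℝ) ^ (s - b) with hτ
  have hτ' : τ = 2 ^ s * ((2 : ℝ) ^ b)⁻¹ := by
    rw [hτ, Real.rpow_sub two_pos, Real.rpow_natCast, div_eq_mul_inv]
  have h2s : 1 ≤ (2 : ℝ) ^ s := Real.one_le_rpow one_le_two hs0
  have hq : ∀ l : ℕ, ((2 ^ l : ℕ) : ℝ) ^ b = (2 ^ b) ^ l := fun l => by
    push_cast; rw [← pow_mul, ← pow_mul, mul_comm]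
  have hle : ∀ l : ℕ, A / ((2 ^ l : ℕ) : ℝ) ^ b ≤ A * τ ^ l := by
    intro l
    rw [hq, div_eq_mul_inv, hτ', mul_pow, ← inv_pow]
    gcongr
    exact le_mul_of_one_le_left (by positivity) (one_le_pow₀ h2s)
  -- The first summand serves the increments: `2 * A` from the triangle inequality, `2 ^ s` from
  -- their degree `2^(l+1)` instead of `2^l`. The second serves the uniform error.
  refine ⟨B * 2 ^ s * (2 * A) + A, by positivity, P, hdeg, fun l => ?_, fun l z => ?_⟩
  · have hz : ∀ z ∈ prodSet K₁ K₂, |eval z (P (l + 1) - P l)| ≤ 2 * A * ((2 ^ b)⁻¹) ^ l := by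
      intro z hz
      have e1 := hPf l ⟨z, hz⟩
      have e2 := hPf (l + 1) ⟨z, hz⟩
      have e3 : A / ((2 ^ (l + 1) : ℕ) : ℝ) ^ b ≤ A * ((2 ^ b)⁻¹) ^ l := by
        rw [inv_pow, ← hq, ← div_eq_mul_inv]
        gcongr
        · norm_num
        · omega
      rw [hq, div_eq_mul_inv, ← inv_pow] at e1
      rw [map_sub, abs_le]
      rw [abs_le] at e1 e2
      dsimp only at e1 e2
      constructor <;> linarith
    have hd : (P (l + 1) - P l).totalDegree ≤ 2 ^ (l + 1) :=
      (totalDegree_sub _ _).trans (max_le (hdeg _)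
        ((hdeg l).trans (Nat.pow_le_pow_right two_pos l.le_succ)))
    intro k₁ hk₁ k₂ hk₂ w₁ w₂ x hx y hy
    refine (H _ Nat.one_le_two_pow _ hd _ (by positivity) hz k₁ hk₁ k₂ hk₂ w₁ w₂ x hx y hy).trans ?_
    have e : ((2 ^ (l + 1) : ℕ) : ℝ) ^ s = 2 ^ s * (2 ^ s) ^ l := by
      push_cast
      rw [← Real.rpow_natCast, ← Real.rpow_natCast, ← Real.rpow_mul two_pos.le,
        ← Real.rpow_mul two_pos.le, ← Real.rpow_add two_pos]
      congr 1
      push_cast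
      ring
    rw [e, hτ', mul_pow]
    have h0 : 0 ≤ A * ((2 ^ s) ^ l * ((2 ^ b : ℝ)⁻¹) ^ l) := by positivity
    linarith
  · refine (hPf l z).trans ((hle l).trans ?_)
    gcongr
    have : 0 ≤ B * 2 ^ s * (2 * A) := by positivity
    linarith

end Jackson

/-! ### Products of fat compact sets. -/

section FatProducts

variable {ι₁ ι₂ : Type*}

theorem prodSet_eq_preimage (A : Set (ι₁ → ℝ)) (B : Set (ι₂ → ℝ)) :
    prodSet A B = Homeomorph.sumArrowHomeomorphProdArrow ⁻¹' (A ×ˢ B) := rfl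

theorem isCompact_prodSet {A : Set (ι₁ → ℝ)} {B : Set (ι₂ → ℝ)} (hA : IsCompact A)
    (hB : IsCompact B) : IsCompact (prodSet A B) := by
  rw [prodSet_eq_preimage, Homeomorph.isCompact_preimage]
  exact hA.prod hB

theorem closure_interior_prodSet {A : Set (ι₁ → ℝ)} {B : Set (ι₂ → ℝ)}
    (hA : closure (interior A) = A) (hB : closure (interior B) = B) :
    closure (interior (prodSet A B)) = prodSet A B := by
  rw [prodSet_eq_preimage, ← Homeomorph.preimage_interior, ← Homeomorph.preimage_closure,
    interior_prod_eq, closure_prod_eq, hA, hB]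

end FatProducts

/-! ### Sections and partial applications of `C^b` functions on the product. -/

section Tensor

theorem CmSpace.toMap_add {ι : Type*} [Fintype ι] [DecidableEq ι] {a : ℕ} {K : Set (ι → ℝ)}
    (f g : CmSpace a K) (x : K) : (f + g).toMap x = f.toMap x + g.toMap x := rfl

theorem CmSpace.toMap_smul {ι : Type*} [Fintype ι] [DecidableEq ι] {a : ℕ} {K : Set (ι → ℝ)}
    (c : ℝ) (f : CmSpace a K) (x : K) : (c • f).toMap x = c * f.toMap x := rfl

open MvPolynomial

variable {ι₁ ι₂ : Type*} [Fintype ι₁] [DecidableEq ι₁] [Fintype ι₂] [DecidableEq ι₂]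

/-- A continuous linear form, restricted to polynomials. -/
def polyForm {ι : Type*} [Fintype ι] [DecidableEq ι] {a : ℕ} {K : Set (ι → ℝ)}
    (ν : CmSpace a K →L[ℝ] ℝ) : MvPolynomial ι ℝ →ₗ[ℝ] ℝ :=
  (ν : CmSpace a K →ₗ[ℝ] ℝ) ∘ₗ polyCm a K

@[simp]
theorem polyForm_apply {ι : Type*} [Fintype ι] [DecidableEq ι] {a : ℕ} {K : Set (ι → ℝ)}
    (ν : CmSpace a K →L[ℝ] ℝ) (v : MvPolynomial ι ℝ) : polyForm ν v = ν (polyCm a K v) := rfl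

/-- The maps `f ↦ f (x, ·)` and `f ↦ (x ↦ ν (f (x, ·)))` on `C^b(K₁ × K₂)`. -/
structure PartialMaps (a b : ℕ) (K₁ : Set (ι₁ → ℝ)) (K₂ : Set (ι₂ → ℝ)) where
  sec : K₁ → (CmSpace b (prodSet K₁ K₂) →L[ℝ] CmSpace a K₂)
  part : (CmSpace a K₂ →L[ℝ] ℝ) →ₗ[ℝ] (CmSpace b (prodSet K₁ K₂) →L[ℝ] CmSpace a K₁)
  toMap_sec : ∀ x f y, (sec x f).toMap y = f.toMap (prodPoint x y)
  toMap_part : ∀ ν f x, (part ν f).toMap x = ν (sec x f)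

variable {K₁ : Set (ι₁ → ℝ)} {K₂ : Set (ι₂ → ℝ)}

theorem IsGeomApprox.tendsto_eval {m b : ℕ} {τ A : ℝ} {f : CmSpace b (prodSet K₁ K₂)}
    {P : ℕ → MvPolynomial (ι₁ ⊕ ι₂) ℝ} (h : IsGeomApprox m τ A f P) (hτ : 0 ≤ τ) (hτ1 : τ < 1)
    (z : prodSet K₁ K₂) : Tendsto (fun l => eval (z : ι₁ ⊕ ι₂ → ℝ) (P l)) atTop (𝓝 (f.toMap z)) := by
  rw [tendsto_iff_norm_sub_tendsto_zero]
  refine squeeze_zero (fun _ => norm_nonneg _) (fun l => ?_)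
    (by simpa using (tendsto_pow_atTop_nhds_zero_of_lt_one hτ hτ1).const_mul A)
  rw [norm_sub_rev]
  exact h.abs_sub_le l z

/-- An additive map on polynomials that is bounded by the mixed derivatives maps approximating
sequences to convergent ones. -/
theorem IsGeomApprox.exists_tendsto {m b : ℕ} {τ A : ℝ} {f : CmSpace b (prodSet K₁ K₂)}
    {P : ℕ → MvPolynomial (ι₁ ⊕ ι₂) ℝ} (h : IsGeomApprox m τ A f P) (hA : 0 ≤ A) (hτ : 0 ≤ τ)
    (hτ1 : τ < 1) {F : Type*} [NormedAddCommGroup F] [NormedSpace ℝ F] [CompleteSpace F]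
    (L : MvPolynomial (ι₁ ⊕ ι₂) ℝ → F) (hsub : ∀ p q, L (p - q) = L p - L q) {B : ℝ}
    (hL : ∀ g c, 0 ≤ c → MixedBound m K₁ K₂ g c → ‖L g‖ ≤ B * c) :
    ∃ G, Tendsto (fun l => L (P l)) atTop (𝓝 G) := by
  refine cauchySeq_tendsto_of_complete
    (cauchySeq_of_le_geometric τ (B * A) hτ1 fun l => ?_)
  rw [dist_comm, dist_eq_norm, ← hsub, mul_assoc]
  exact hL _ _ (by positivity) (h.mixedBound l)

theorem exists_norm_bound {E : Type*} [NormedAddCommGroup E] [NormedSpace ℝ E] (ν : E →L[ℝ] ℝ) :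
    ∃ A : ℝ, 0 ≤ A ∧ ∀ f, |ν f| ≤ A * ‖f‖ :=
  ⟨‖ν‖, norm_nonneg _, fun f => ν.le_opNorm f⟩

variable [CompactSpace K₁] [CompactSpace K₂]

theorem norm_polyCm_mono {ι : Type*} [Fintype ι] [DecidableEq ι] {K : Set (ι → ℝ)} [CompactSpace K]
    {a m : ℕ} (ham : a ≤ m) (p : MvPolynomial ι ℝ) : ‖polyCm a K p‖ ≤ ‖polyCm m K p‖ :=
  norm_polyCm_le (norm_nonneg _) fun _ hk w x =>
    abs_eval_wordPderiv_le_norm p (hk.trans ham) w x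

/-- The sections of the approximants are Cauchy in `C^a(K₂)`, and point evaluations identify the
limit. Only order zero in the first group is needed. -/
theorem IsGeomApprox.exists_tendsto_section {a m b : ℕ} (ham : a ≤ m) {τ A : ℝ} (hA : 0 ≤ A) (hτ : 0 ≤ τ) (hτ1 : τ < 1)
    {f : CmSpace b (prodSet K₁ K₂)} {P : ℕ → MvPolynomial (ι₁ ⊕ ι₂) ℝ}
    (hP : IsGeomApprox m τ A f P) (x : K₁) :
    ∃ G : CmSpace a K₂, Tendsto (fun l => polyCm a K₂ (sectionRight (x : ι₁ → ℝ) (P l))) atTop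
      (𝓝 G) ∧ ∀ y, G.toMap y = f.toMap (prodPoint x y) := by
  have hL : ∀ g c, 0 ≤ c → MixedBound m K₁ K₂ g c →
      ‖polyCm a K₂ (sectionRight (x : ι₁ → ℝ) g)‖ ≤ 1 * c := fun g c hc hg => by
    rw [one_mul]
    exact (norm_polyCm_mono ham _).trans
      (hg.norm_sectionRight_le hc (Nat.zero_le m) (fun j => j.elim0) x.2)
  obtain ⟨G, hG⟩ := hP.exists_tendsto hA hτ hτ1 (F := CmSpace a K₂)
    (fun g => polyCm a K₂ (sectionRight (x : ι₁ → ℝ) g)) (fun p q => by rw [map_sub, map_sub]) hL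
  refine ⟨G, hG, fun y => tendsto_nhds_unique
    (((CmSpace.evalCLM a y).continuous.tendsto _).comp hG) ?_⟩
  refine (hP.tendsto_eval hτ hτ1 (prodPoint x y)).congr fun l => ?_
  exact (eval_sectionRight _ _ _).symm

/-- The same Cauchy argument in `C^a(K₁)`; the limit is identified pointwise by applying the
continuous form `ν` to the convergent sections. -/
theorem IsGeomApprox.exists_tendsto_partialApply (hK₂ : closure (interior K₂) = K₂) {a m b : ℕ}
    (ham : a ≤ m) {τ A : ℝ} (hA : 0 ≤ A) (hτ : 0 ≤ τ) (hτ1 : τ < 1)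
    {f : CmSpace b (prodSet K₁ K₂)} {P : ℕ → MvPolynomial (ι₁ ⊕ ι₂) ℝ}
    (hP : IsGeomApprox m τ A f P) (ν : CmSpace a K₂ →L[ℝ] ℝ) {s : K₁ → CmSpace a K₂}
    (hs : ∀ x y, (s x).toMap y = f.toMap (prodPoint x y)) :
    ∃ G : CmSpace a K₁, Tendsto (fun l => polyCm a K₁ (partialApply (polyForm ν) (P l))) atTop
      (𝓝 G) ∧ ∀ x, G.toMap x = ν (s x) := by
  obtain ⟨B, hB, hν⟩ := exists_norm_bound (E := CmSpace a K₂) ν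
  have hν' : ∀ v, |polyForm ν v| ≤ B * ‖polyCm m K₂ v‖ := fun v => by
    have h1 : |polyForm ν v| ≤ B * ‖polyCm a K₂ v‖ := hν (polyCm a K₂ v)
    exact h1.trans (mul_le_mul_of_nonneg_left (norm_polyCm_mono ham v) hB)
  have hL : ∀ g c, 0 ≤ c → MixedBound m K₁ K₂ g c →
      ‖polyCm a K₁ (partialApply (polyForm ν) g)‖ ≤ B * c := fun g c hc hg =>
    (norm_polyCm_mono ham _).trans (hg.norm_partialApply_le hc hB hν')
  obtain ⟨G, hG⟩ := hP.exists_tendsto hA hτ hτ1 (F := CmSpace a K₁)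
    (fun g => polyCm a K₁ (partialApply (polyForm ν) g)) (fun p q => by rw [map_sub, map_sub]) hL
  refine ⟨G, hG, fun x => ?_⟩
  have h1 : Tendsto (fun l => (polyCm a K₁ (partialApply (polyForm ν) (P l))).toMap x) atTop
      (𝓝 (G.toMap x)) := ((CmSpace.evalCLM a x).continuous.tendsto _).comp hG
  obtain ⟨g, hg, hg'⟩ := hP.exists_tendsto_section ham hA hτ hτ1 x
  have hsg : s x = g := CmSpace.ext_toMap hK₂ fun y => (hs x y).trans (hg' y).symm
  have h2 : Tendsto (fun l => ν (polyCm a K₂ (sectionRight (x : ι₁ → ℝ) (P l)))) atTop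
      (𝓝 (ν g)) := (ν.continuous.tendsto _).comp hg
  rw [hsg]
  refine tendsto_nhds_unique h1 (h2.congr fun l => ?_)
  rw [toMap_polyCm, eval_partialApply, polyForm_apply]

/-- For each `f` the limits along its approximants provide the images; since point evaluations
separate, the images are unique, hence linear, and the closed graph theorem gives continuity. -/
theorem nonempty_partialMaps (hK₁ : closure (interior K₁) = K₁) (hK₂ : closure (interior K₂) = K₂)
    {a m b : ℕ} (ham : a ≤ m) {τ : ℝ} (hτ : 0 ≤ τ) (hτ1 : τ < 1)
    (happ : ∀ f : CmSpace b (prodSet K₁ K₂), ∃ A : ℝ, 0 ≤ A ∧ ∃ P, IsGeomApprox m τ A f P) :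
    Nonempty (PartialMaps a b K₁ K₂) := by
  have : CompactSpace (prodSet K₁ K₂) := isCompact_iff_compactSpace.1
    (isCompact_prodSet (isCompact_iff_compactSpace.2 ‹_›) (isCompact_iff_compactSpace.2 ‹_›))
  have hsec : ∀ x : K₁, ∃ S : CmSpace b (prodSet K₁ K₂) →L[ℝ] CmSpace a K₂,
      ∀ f y, (S f).toMap y = f.toMap (prodPoint x y) := by
    intro x
    refine exists_clm_of_separating (E := CmSpace b (prodSet K₁ K₂)) (F := CmSpace a K₂)
      (fun y : K₂ => CmSpace.evalCLM b (prodPoint x y))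
      (fun y : K₂ => CmSpace.evalCLM a y) (fun g g' hg => CmSpace.ext_toMap hK₂ hg) fun f => ?_
    obtain ⟨A, hA, P, hP⟩ := happ f
    obtain ⟨G, -, hG⟩ := hP.exists_tendsto_section ham hA hτ hτ1 x
    exact ⟨G, hG⟩
  choose S hS using hsec
  have hpart : ∀ ν : CmSpace a K₂ →L[ℝ] ℝ, ∃ T : CmSpace b (prodSet K₁ K₂) →L[ℝ] CmSpace a K₁,
      ∀ f x, (T f).toMap x = ν (S x f) := by
    intro ν
    refine exists_clm_of_separating (E := CmSpace b (prodSet K₁ K₂)) (F := CmSpace a K₁)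
      (fun x : K₁ => (ContinuousLinearMap.comp ν (S x) : CmSpace b (prodSet K₁ K₂) →L[ℝ] ℝ))
      (fun x : K₁ => CmSpace.evalCLM a x) (fun g g' hg => CmSpace.ext_toMap hK₁ hg) fun f => ?_
    obtain ⟨A, hA, P, hP⟩ := happ f
    obtain ⟨G, -, hG⟩ := hP.exists_tendsto_partialApply hK₂ ham hA hτ hτ1 ν
      (s := fun x => S x f) fun x y => hS x f y
    exact ⟨G, hG⟩
  choose T hT using hpart
  exact ⟨⟨S,
    { toFun := T
      map_add' := fun ν ν' => ContinuousLinearMap.ext fun f => CmSpace.ext_toMap hK₁ fun x => by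
        rw [add_apply, CmSpace.toMap_add, hT, hT, hT, add_apply]
      map_smul' := fun c ν => ContinuousLinearMap.ext fun f => CmSpace.ext_toMap hK₁ fun x => by
        rw [RingHom.id_apply, smul_apply, CmSpace.toMap_smul, hT, hT, smul_apply, smul_eq_mul] },
    fun x f y => hS x f y, fun ν f x => hT ν f x⟩⟩

end Tensor

/-! ### Tensor products of continuous linear forms. -/

namespace PartialMaps

open MvPolynomial

variable {ι₁ ι₂ : Type*} [Fintype ι₁] [DecidableEq ι₁] [Fintype ι₂] [DecidableEq ι₂]
  {K₁ : Set (ι₁ → ℝ)} {K₂ : Set (ι₂ → ℝ)} {a b : ℕ} (D : PartialMaps a b K₁ K₂)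

/-- The tensor product of two continuous linear forms. -/
def tens : (CmSpace a K₁ →L[ℝ] ℝ) →ₗ[ℝ] (CmSpace a K₂ →L[ℝ] ℝ) →ₗ[ℝ]
    (CmSpace b (prodSet K₁ K₂) →L[ℝ] ℝ) :=
  LinearMap.mk₂ ℝ (fun μ ν => μ.comp (D.part ν)) (fun _ _ _ => rfl) (fun _ _ _ => rfl)
    (fun μ ν ν' => by rw [map_add, ContinuousLinearMap.comp_add])
    (fun c μ ν => by rw [map_smul, ContinuousLinearMap.comp_smul])

theorem tens_apply (μ : CmSpace a K₁ →L[ℝ] ℝ) (ν : CmSpace a K₂ →L[ℝ] ℝ)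
    (f : CmSpace b (prodSet K₁ K₂)) : D.tens μ ν f = μ (D.part ν f) := rfl

theorem isTensor_tens (μ : CmSpace a K₁ →L[ℝ] ℝ) (ν : CmSpace a K₂ →L[ℝ] ℝ) :
    IsTensor μ ν (D.tens μ ν) := fun f =>
  ⟨fun x => D.sec x f, D.part ν f, fun x y => D.toMap_sec x f y, fun x => D.toMap_part ν f x, rfl⟩

/-- The functions witnessing a tensor product are fixed by their values, so on fat sets there is no
choice. -/
theorem eq_tens_of_isTensor (hK₁ : closure (interior K₁) = K₁) (hK₂ : closure (interior K₂) = K₂)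
    {μ : CmSpace a K₁ →L[ℝ] ℝ} {ν : CmSpace a K₂ →L[ℝ] ℝ}
    {lam : CmSpace b (prodSet K₁ K₂) →L[ℝ] ℝ} (h : IsTensor μ ν lam) : lam = D.tens μ ν := by
  ext f
  obtain ⟨F, g, hF, hg, hlam⟩ := h f
  have hFs : ∀ x, F x = D.sec x f := fun x => CmSpace.ext_toMap hK₂ fun y => by
    rw [hF, D.toMap_sec]
  have hgp : g = D.part ν f := CmSpace.ext_toMap hK₁ fun x => by
    rw [hg, D.toMap_part, hFs]
  rw [hlam, hgp, tens_apply]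

/-- Point evaluations are tensor products, so identities for `D.tens` determine values of functions
on the product. -/
theorem tens_eval (x : K₁) (y : K₂) (f : CmSpace b (prodSet K₁ K₂)) :
    D.tens (CmSpace.evalCLM a x) (CmSpace.evalCLM a y) f = f.toMap (prodPoint x y) := by
  rw [tens_apply, CmSpace.evalCLM_apply, D.toMap_part, CmSpace.evalCLM_apply, D.toMap_sec]

theorem part_polyCm (hK₁ : closure (interior K₁) = K₁) (hK₂ : closure (interior K₂) = K₂)
    (ν : CmSpace a K₂ →L[ℝ] ℝ) (h : MvPolynomial (ι₁ ⊕ ι₂) ℝ) :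
    D.part ν (polyCm b (prodSet K₁ K₂) h) = polyCm a K₁ (partialApply (polyForm ν) h) := by
  refine CmSpace.ext_toMap hK₁ fun x => ?_
  rw [D.toMap_part, toMap_polyCm, eval_partialApply, polyForm_apply]
  refine congrArg ν (CmSpace.ext_toMap hK₂ fun y => ?_)
  rw [D.toMap_sec, toMap_polyCm, toMap_polyCm, eval_sectionRight]
  rfl

theorem tens_mulPoly (hK₁ : closure (interior K₁) = K₁) (hK₂ : closure (interior K₂) = K₂)
    (μ : CmSpace a K₁ →L[ℝ] ℝ) (ν : CmSpace a K₂ →L[ℝ] ℝ) (u : MvPolynomial ι₁ ℝ)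
    (v : MvPolynomial ι₂ ℝ) : D.tens μ ν (polyCm b (prodSet K₁ K₂) (mulPoly u v)) =
      μ (polyCm a K₁ u) * ν (polyCm a K₂ v) := by
  rw [tens_apply, D.part_polyCm hK₁ hK₂, partialApply_mulPoly, map_smul, map_smul, polyForm_apply,
    smul_eq_mul, mul_comm]

/-- The approximants are not known to converge to `f` in `C^b(K₁ × K₂)`, so continuity of `D.part ν`
would not suffice; the control of mixed derivatives does. -/
theorem tendsto_part [CompactSpace K₁] [CompactSpace K₂] (hK₁ : closure (interior K₁) = K₁)
    (hK₂ : closure (interior K₂) = K₂) {m : ℕ} (ham : a ≤ m) {τ A : ℝ} (hA : 0 ≤ A) (hτ : 0 ≤ τ)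
    (hτ1 : τ < 1) {f : CmSpace b (prodSet K₁ K₂)} {P : ℕ → MvPolynomial (ι₁ ⊕ ι₂) ℝ}
    (hP : IsGeomApprox m τ A f P) (ν : CmSpace a K₂ →L[ℝ] ℝ) :
    Tendsto (fun l => D.part ν (polyCm b (prodSet K₁ K₂) (P l))) atTop (𝓝 (D.part ν f)) := by
  obtain ⟨G, hG, hG'⟩ := hP.exists_tendsto_partialApply hK₂ ham hA hτ hτ1 ν
    (s := fun x => D.sec x f) fun x y => D.toMap_sec x f y
  rw [show D.part ν f = G from CmSpace.ext_toMap hK₁ fun x => by rw [D.toMap_part, hG']]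
  exact hG.congr fun l => (D.part_polyCm hK₁ hK₂ ν (P l)).symm

theorem tendsto_tens [CompactSpace K₁] [CompactSpace K₂] (hK₁ : closure (interior K₁) = K₁)
    (hK₂ : closure (interior K₂) = K₂) {m : ℕ} (ham : a ≤ m) {τ A : ℝ} (hA : 0 ≤ A) (hτ : 0 ≤ τ)
    (hτ1 : τ < 1) {f : CmSpace b (prodSet K₁ K₂)} {P : ℕ → MvPolynomial (ι₁ ⊕ ι₂) ℝ}
    (hP : IsGeomApprox m τ A f P) (μ : CmSpace a K₁ →L[ℝ] ℝ) (ν : CmSpace a K₂ →L[ℝ] ℝ) :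
    Tendsto (fun l => D.tens μ ν (polyCm b (prodSet K₁ K₂) (P l))) atTop (𝓝 (D.tens μ ν f)) :=
  (μ.continuous.tendsto _).comp (D.tendsto_part hK₁ hK₂ ham hA hτ hτ1 hP ν)

end PartialMaps

/-! ### Finite expansions of polynomial-valued operators. -/

section FiniteRank

open MvPolynomial

/-- The coordinate forms of a basis of `V` are extended to `E` by Hahn–Banach, so they can be
composed with operators on `E`. -/
theorem exists_finite_expansion {E : Type*} [NormedAddCommGroup E] [NormedSpace ℝ E]
    (V : Submodule ℝ E) [FiniteDimensional ℝ V] :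
    ∃ (n : ℕ) (c : Fin n → E →L[ℝ] ℝ) (e : Fin n → E), (∀ s, e s ∈ V) ∧
      ∀ f ∈ V, f = ∑ s, c s f • e s := by
  let B := Module.finBasis ℝ V
  have h : ∀ s, ∃ g : E →L[ℝ] ℝ, ∀ v : V, g v = B.coord s v := fun s => by
    obtain ⟨g, hg, -⟩ := exists_extension_norm_eq V (B.coord s).toContinuousLinearMap
    exact ⟨g, fun v => hg v⟩
  choose c hc using h
  refine ⟨_, c, fun s => B s, fun s => (B s).2, fun f hf => ?_⟩
  have h2 := congrArg (Subtype.val) (B.sum_repr ⟨f, hf⟩)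
  rw [Submodule.coe_sum] at h2
  refine h2.symm.trans (Finset.sum_congr rfl fun s _ => ?_)
  rw [hc s ⟨f, hf⟩]
  rfl

instance finiteDimensional_restrictTotalDegree {ι : Type*} [Finite ι] (d : ℕ) :
    FiniteDimensional ℝ (restrictTotalDegree ι ℝ d) := by
  have hfin : Finite {n : ι →₀ ℕ | (n.sum fun _ e => e) ≤ d} :=
    (Finsupp.finite_of_degree_le d).to_subtype
  exact Module.Finite.of_basis (basisRestrictSupport ℝ {n : ι →₀ ℕ | (n.sum fun _ e => e) ≤ d})

variable {ι : Type*} [Fintype ι] [DecidableEq ι]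

theorem finiteDimensional_polySubmodule {a d : ℕ} {K : Set (ι → ℝ)}
    (hK : closure (interior K) = K) : FiniteDimensional ℝ (polySubmodule a K d) := by
  refine Submodule.finiteDimensional_of_le (S₂ := (restrictTotalDegree ι ℝ d).map (polyCm a K)) ?_
  intro f hf
  obtain ⟨p, hp, rfl⟩ := exists_polyCm_eq hK hf
  exact ⟨p, (mem_restrictTotalDegree _ _ _).2 hp, rfl⟩

theorem exists_poly_expansion {K : Set (ι → ℝ)} [CompactSpace K]
    (hK : closure (interior K) = K) (a d : ℕ) :
    ∃ (n : ℕ) (c : Fin n → CmSpace a K →L[ℝ] ℝ) (u : Fin n → MvPolynomial ι ℝ),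
      (∀ s, (u s).totalDegree ≤ d) ∧
      ∀ f ∈ polySubmodule a K d, f = ∑ s, c s f • polyCm a K (u s) := by
  have := finiteDimensional_polySubmodule (a := a) (d := d) hK
  obtain ⟨n, c, e, he, H⟩ := exists_finite_expansion (E := CmSpace a K) (polySubmodule a K d)
  choose u hu hu' using fun s => exists_polyCm_eq hK (he s)
  refine ⟨n, c, u, hu, fun f hf => (H f hf).trans (Finset.sum_congr rfl fun s _ => ?_)⟩
  rw [hu' s]

end FiniteRank

/-! ### Tensor products of operators. -/

section TensorOperator

open MvPolynomial

variable {ι₁ ι₂ : Type*} [Fintype ι₁] [DecidableEq ι₁] [Fintype ι₂] [DecidableEq ι₂]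
  {K₁ : Set (ι₁ → ℝ)} {K₂ : Set (ι₂ → ℝ)} {a b : ℕ}

theorem comp_eq_sum {E : Type*} [AddCommGroup E] [Module ℝ E] [TopologicalSpace E] {n : ℕ}
    {c : Fin n → E →L[ℝ] ℝ} {e : Fin n → E} {A : E →L[ℝ] E}
    (hA : ∀ f, A f = ∑ s, c s (A f) • e s) (μ : E →L[ℝ] ℝ) :
    μ.comp A = ∑ s, μ (e s) • (c s).comp A := by
  ext f
  rw [ContinuousLinearMap.comp_apply, hA f, map_sum, sum_apply]
  refine Finset.sum_congr rfl fun s _ => ?_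
  rw [map_smul, smul_apply, ContinuousLinearMap.comp_apply, smul_eq_mul, smul_eq_mul, mul_comm]

/-- The tensor product of two operators whose ranges consist of polynomials. -/
theorem PartialMaps.exists_tensorOperator [CompactSpace K₁] [CompactSpace K₂]
    (D : PartialMaps a b K₁ K₂) (hK₁ : closure (interior K₁) = K₁)
    (hK₂ : closure (interior K₂) = K₂) {A : CmSpace a K₁ →L[ℝ] CmSpace a K₁}
    {B : CmSpace a K₂ →L[ℝ] CmSpace a K₂} {i j : ℕ} (hA : ∀ f, A f ∈ polySubmodule a K₁ i)
    (hB : ∀ f, B f ∈ polySubmodule a K₂ j) :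
    ∃ T : CmSpace b (prodSet K₁ K₂) →L[ℝ] CmSpace b (prodSet K₁ K₂),
      (∀ f, T f ∈ polySubmodule b (prodSet K₁ K₂) (i + j)) ∧
      (∀ (μ : CmSpace a K₁ →L[ℝ] ℝ) (ν : CmSpace a K₂ →L[ℝ] ℝ) f, D.tens μ ν (T f) = D.tens (μ.comp A) (ν.comp B) f) ∧
      ∀ lam : CmSpace b (prodSet K₁ K₂) →L[ℝ] ℝ, lam.comp T ∈
        Submodule.span ℝ {l | ∃ (μ : CmSpace a K₁ →L[ℝ] ℝ) (ν : CmSpace a K₂ →L[ℝ] ℝ),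
          l = D.tens (μ.comp A) (ν.comp B)} := by
  obtain ⟨n₁, c, u, hu, hc⟩ := exists_poly_expansion hK₁ a i
  obtain ⟨n₂, e, v, hv, he⟩ := exists_poly_expansion hK₂ a j
  -- Writing `A = ∑ (c_s ∘ A) u_s` and `B = ∑ (e_t ∘ B) v_t` forces `A ⊗ B = ∑ ((c_s ∘ A) ⊗ (e_t ∘
  -- B)) u_s v_t`, a continuous operator of finite rank.
  let S : Fin n₁ × Fin n₂ → CmSpace b (prodSet K₁ K₂) →L[ℝ] ℝ :=
    fun s => D.tens ((c s.1).comp A) ((e s.2).comp B)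
  let w : Fin n₁ × Fin n₂ → CmSpace b (prodSet K₁ K₂) :=
    fun s => polyCm b (prodSet K₁ K₂) (mulPoly (u s.1) (v s.2))
  let T : CmSpace b (prodSet K₁ K₂) →L[ℝ] CmSpace b (prodSet K₁ K₂) :=
    ∑ s, (S s).smulRight (w s)
  have hT : ∀ f, T f = ∑ s, S s f • w s := fun f => by
    simp only [T, sum_apply, ContinuousLinearMap.smulRight_apply]
  refine ⟨T, fun f => ?_, fun μ ν f => ?_, fun lam => ?_⟩
  · rw [hT]
    refine Submodule.sum_mem _ fun s _ => Submodule.smul_mem _ _ (polyCm_mem ?_)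
    exact (totalDegree_mulPoly_le _ _).trans (add_le_add (hu _) (hv _))
  · rw [comp_eq_sum (fun f => hc _ (hA f)), comp_eq_sum (fun f => he _ (hB f)), hT, map_sum,
      LinearMap.map_sum₂, Fintype.sum_prod_type, sum_apply]
    refine Finset.sum_congr rfl fun s _ => ?_
    rw [map_sum, sum_apply]
    refine Finset.sum_congr rfl fun t _ => ?_
    rw [map_smul, map_smul, map_smul, LinearMap.smul_apply, smul_apply, smul_apply,
      D.tens_mulPoly hK₁ hK₂]
    simp only [smul_eq_mul, S]
    ring
  · have : lam.comp T = ∑ s, lam (w s) • S s := by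
      ext f
      rw [ContinuousLinearMap.comp_apply, hT, map_sum, sum_apply]
      refine Finset.sum_congr rfl fun s _ => ?_
      rw [map_smul, smul_apply, smul_eq_mul, smul_eq_mul, mul_comm]
    rw [this]
    exact Submodule.sum_mem _ fun s _ => Submodule.smul_mem _ _
      (Submodule.subset_span ⟨c s.1, e s.2, rfl⟩)

end TensorOperator

/-! ### Polynomial projectors and differences in a Newton sequence. -/

section Projectors

open MvPolynomial

variable {ι : Type*} [Fintype ι] [DecidableEq ι] {a : ℕ} {K : Set (ι → ℝ)}

theorem IsPolyProjector.mem {d : ℕ} {P : CmSpace a K →L[ℝ] CmSpace a K}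
    (hP : IsPolyProjector d P) (f : CmSpace a K) : P f ∈ polySubmodule a K d :=
  hP.2 ▸ LinearMap.mem_range_self (P : CmSpace a K →ₗ[ℝ] CmSpace a K) f

theorem IsPolyProjector.apply_of_mem {d : ℕ} {P : CmSpace a K →L[ℝ] CmSpace a K}
    (hP : IsPolyProjector d P) {f : CmSpace a K} (hf : f ∈ polySubmodule a K d) : P f = f := by
  rw [← hP.2] at hf
  obtain ⟨g, rfl⟩ := hf
  exact hP.1 g

theorem isPolyProjector_of {d : ℕ} {P : CmSpace a K →L[ℝ] CmSpace a K}
    (h : ∀ f, P f ∈ polySubmodule a K d) (h' : ∀ f ∈ polySubmodule a K d, P f = f) :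
    IsPolyProjector d P := by
  refine ⟨fun f => h' _ (h f), le_antisymm ?_ fun f hf => ⟨f, h' f hf⟩⟩
  rintro _ ⟨f, rfl⟩
  exact h f

theorem mem_interpSpace {P : CmSpace a K →L[ℝ] CmSpace a K} {ν : CmSpace a K →L[ℝ] ℝ} :
    ν ∈ interpSpace P ↔ ν.comp P = ν :=
  ⟨fun h => ContinuousLinearMap.ext fun f => (h f).symm,
    fun h f => (congrArg (fun l : CmSpace a K →L[ℝ] ℝ => l f) h).symm⟩

theorem IsPolyProjector.comp_mem {d : ℕ} {P : CmSpace a K →L[ℝ] CmSpace a K}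
    (hP : IsPolyProjector d P) (ν : CmSpace a K →L[ℝ] ℝ) : ν.comp P ∈ interpSpace P := fun f => by
  rw [ContinuousLinearMap.comp_apply, ContinuousLinearMap.comp_apply, hP.1]

/-- A polynomial projector is determined by its interpolation conditions. -/
theorem IsPolyProjector.eq_of_interpSpace_le (hK : closure (interior K) = K) {d : ℕ}
    {P Q : CmSpace a K →L[ℝ] CmSpace a K} (hP : IsPolyProjector d P) (hQ : IsPolyProjector d Q)
    (h : interpSpace P ≤ interpSpace Q) : P = Q := by
  ext1 f
  refine CmSpace.ext_toMap hK fun x => ?_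
  have h1 := h (hP.comp_mem (CmSpace.evalCLM a x)) f
  simp only [ContinuousLinearMap.comp_apply, CmSpace.evalCLM_apply] at h1
  rw [h1, hP.apply_of_mem (hQ.mem f)]

namespace NewtonSequence

variable (N : NewtonSequence a K)

theorem interpSpace_mono {i j : ℕ} (hij : i ≤ j) :
    interpSpace (N.proj i) ≤ interpSpace (N.proj j) :=
  monotone_nat_of_le_succ N.interpSpace_le hij

/-- The difference of consecutive projectors. -/
def delta : ℕ → (CmSpace a K →L[ℝ] CmSpace a K)
  | 0 => N.proj 0
  | i + 1 => N.proj (i + 1) - N.proj i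

theorem sum_delta (i : ℕ) : ∑ s ∈ Finset.range (i + 1), N.delta s = N.proj i := by
  induction i with
  | zero => simp [delta]
  | succ i ih => rw [Finset.sum_range_succ, ih, delta]; abel

theorem polySubmodule_mono {i j : ℕ} (hij : i ≤ j) : polySubmodule a K i ≤ polySubmodule a K j :=
  fun _ ⟨p, hp, h⟩ => ⟨p, hp.trans hij, h⟩

theorem delta_mem (i : ℕ) (f : CmSpace a K) : N.delta i f ∈ polySubmodule a K i := by
  cases i with
  | zero => exact (N.isPolyProjector 0).mem f
  | succ i =>
    exact Submodule.sub_mem _ ((N.isPolyProjector _).mem f)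
      (polySubmodule_mono i.le_succ ((N.isPolyProjector _).mem f))

theorem comp_proj_of_mem {i j : ℕ} (hij : i ≤ j) {μ : CmSpace a K →L[ℝ] ℝ}
    (hμ : μ ∈ interpSpace (N.proj i)) : μ.comp (N.proj j) = μ :=
  mem_interpSpace.1 (N.interpSpace_mono hij hμ)

theorem comp_delta_mem (i : ℕ) (μ : CmSpace a K →L[ℝ] ℝ) :
    μ.comp (N.delta i) ∈ interpSpace (N.proj i) := by
  cases i with
  | zero => exact (N.isPolyProjector 0).comp_mem μ
  | succ i =>
    intro f
    have h1 := (N.isPolyProjector (i + 1)).comp_mem μ f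
    have h2 := N.interpSpace_mono i.le_succ ((N.isPolyProjector i).comp_mem μ) f
    simp only [ContinuousLinearMap.comp_apply] at h1 h2
    simp only [ContinuousLinearMap.comp_apply, delta, sub_apply, map_sub]
    rw [h1, h2]

/-- Both projectors in the difference preserve the condition `μ`, so they cancel;
`delta_apply_eq_zero` is the dual cancellation on polynomials. The two truncate the sums defining
the product. -/
theorem comp_delta_eq_zero {i s : ℕ} (his : i < s) {μ : CmSpace a K →L[ℝ] ℝ}
    (hμ : μ ∈ interpSpace (N.proj i)) : μ.comp (N.delta s) = 0 := by
  obtain ⟨s, rfl⟩ := Nat.exists_eq_succ_of_ne_zero (Nat.ne_zero_of_lt his)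
  ext f
  have h1 := N.interpSpace_mono his.le hμ f
  have h2 := N.interpSpace_mono (Nat.lt_succ_iff.1 his) hμ f
  rw [ContinuousLinearMap.comp_apply, delta, sub_apply, map_sub, ← h1, ← h2, sub_self, zero_apply]

theorem proj_apply_of_mem {i j : ℕ} (hij : i ≤ j) {f : CmSpace a K}
    (hf : f ∈ polySubmodule a K i) : N.proj j f = f :=
  (N.isPolyProjector j).apply_of_mem (polySubmodule_mono hij hf)

theorem delta_apply_eq_zero {i s : ℕ} (his : i < s) {f : CmSpace a K}
    (hf : f ∈ polySubmodule a K i) : N.delta s f = 0 := by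
  obtain ⟨s, rfl⟩ := Nat.exists_eq_succ_of_ne_zero (Nat.ne_zero_of_lt his)
  rw [delta, sub_apply, N.proj_apply_of_mem his.le hf,
    N.proj_apply_of_mem (Nat.lt_succ_iff.1 his) hf, sub_self]

theorem ext_proj {N N' : NewtonSequence a K} (h : ∀ d, N.proj d = N'.proj d) : N = N' := by
  cases N; cases N'
  congr
  exact funext h

end NewtonSequence

end Projectors

/-! ### Existence, uniqueness and compatibility of Newton products. -/

section NewtonProduct

open MvPolynomial

theorem exists_prodPoint_eq {ι₁ ι₂ : Type*} {K₁ : Set (ι₁ → ℝ)} {K₂ : Set (ι₂ → ℝ)}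
    (z : prodSet K₁ K₂) : ∃ (x : K₁) (y : K₂), z = prodPoint x y :=
  ⟨⟨_, z.2.1⟩, ⟨_, z.2.2⟩, Subtype.ext (Sum.elim_comp_inl_inr z.1).symm⟩

variable {ι₁ ι₂ : Type*} [Fintype ι₁] [DecidableEq ι₁] [Fintype ι₂] [DecidableEq ι₂]
  {K₁ : Set (ι₁ → ℝ)} {K₂ : Set (ι₂ → ℝ)} {a b : ℕ}

/-- Terms with `s > i` vanish; for `s ≤ i` one has `d - s ≥ j`, so the second projector reproduces
`g`, and the remaining differences telescope to `f`. -/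
theorem sum_delta_mul_proj (N₁ : NewtonSequence a K₁) (N₂ : NewtonSequence a K₂) {d i j : ℕ}
    (hij : i + j ≤ d) {f : CmSpace a K₁} {g : CmSpace a K₂} (hf : f ∈ polySubmodule a K₁ i)
    (hg : g ∈ polySubmodule a K₂ j) (μ : CmSpace a K₁ →L[ℝ] ℝ) (ν : CmSpace a K₂ →L[ℝ] ℝ) :
    ∑ s ∈ Finset.range (d + 1), μ (N₁.delta s f) * ν (N₂.proj (d - s) g) = μ f * ν g := by
  have h1 : ∑ s ∈ Finset.range (i + 1), μ (N₁.delta s f) * ν (N₂.proj (d - s) g) =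
      ∑ s ∈ Finset.range (d + 1), μ (N₁.delta s f) * ν (N₂.proj (d - s) g) := by
    refine Finset.sum_subset (Finset.range_subset_range.2 (by omega)) fun s _ hs => ?_
    rw [Finset.mem_range, not_lt] at hs
    rw [N₁.delta_apply_eq_zero hs hf, map_zero, zero_mul]
  have h2 : ∑ s ∈ Finset.range (i + 1), N₁.delta s f = f := by
    rw [← sum_apply, N₁.sum_delta, N₁.proj_apply_of_mem le_rfl hf]
  rw [← h1]
  conv_rhs => rw [← h2, map_sum, Finset.sum_mul]
  refine Finset.sum_congr rfl fun s hs => ?_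
  rw [Finset.mem_range] at hs
  rw [N₂.proj_apply_of_mem (show j ≤ d - s by omega) hg]

variable (D : PartialMaps a b K₁ K₂)

theorem PartialMaps.sum_tens_polyCm (hK₁ : closure (interior K₁) = K₁)
    (hK₂ : closure (interior K₂) = K₂) (N₁ : NewtonSequence a K₁) (N₂ : NewtonSequence a K₂)
    {d : ℕ} {p : MvPolynomial (ι₁ ⊕ ι₂) ℝ} (hp : p.totalDegree ≤ d) (μ : CmSpace a K₁ →L[ℝ] ℝ)
    (ν : CmSpace a K₂ →L[ℝ] ℝ) :
    ∑ s ∈ Finset.range (d + 1), D.tens (μ.comp (N₁.delta s)) (ν.comp (N₂.proj (d - s)))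
      (polyCm b (prodSet K₁ K₂) p) = D.tens μ ν (polyCm b (prodSet K₁ K₂) p) := by
  have h := mem_span_mulPoly hp
  clear hp
  induction h using Submodule.span_induction with
  | mem p hp =>
    obtain ⟨u, v, huv, rfl⟩ := hp
    simp only [D.tens_mulPoly hK₁ hK₂, ContinuousLinearMap.comp_apply]
    exact sum_delta_mul_proj N₁ N₂ huv (polyCm_mem le_rfl) (polyCm_mem le_rfl) μ ν
  | zero => simp only [map_zero, Finset.sum_const_zero]
  | add p q _ _ hp hq => simp only [map_add, Finset.sum_add_distrib, hp, hq]
  | smul c p _ hp => simp only [map_smul, ← Finset.smul_sum, hp]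

/-- The same truncation and telescoping, on conditions instead of polynomials. -/
theorem PartialMaps.sum_tens_of_mem_interpSpace (N₁ : NewtonSequence a K₁)
    (N₂ : NewtonSequence a K₂) {d i j : ℕ} (hij : i + j ≤ d) {μ : CmSpace a K₁ →L[ℝ] ℝ}
    {ν : CmSpace a K₂ →L[ℝ] ℝ} (hμ : μ ∈ interpSpace (N₁.proj i))
    (hν : ν ∈ interpSpace (N₂.proj j)) :
    ∑ s ∈ Finset.range (d + 1), D.tens (μ.comp (N₁.delta s)) (ν.comp (N₂.proj (d - s))) =
      D.tens μ ν := by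
  have h1 : ∑ s ∈ Finset.range (i + 1), D.tens (μ.comp (N₁.delta s)) (ν.comp (N₂.proj (d - s))) =
      ∑ s ∈ Finset.range (d + 1), D.tens (μ.comp (N₁.delta s)) (ν.comp (N₂.proj (d - s))) := by
    refine Finset.sum_subset (Finset.range_subset_range.2 (by omega)) fun s _ hs => ?_
    rw [Finset.mem_range, not_lt] at hs
    rw [N₁.comp_delta_eq_zero hs hμ, map_zero, LinearMap.zero_apply]
  have h2 : ∑ s ∈ Finset.range (i + 1), μ.comp (N₁.delta s) = μ := by
    ext f
    rw [sum_apply]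
    simp only [ContinuousLinearMap.comp_apply]
    rw [← map_sum, ← sum_apply, N₁.sum_delta, ← hμ f]
  rw [← h1]
  conv_rhs => rw [← h2, LinearMap.map_sum₂]
  refine Finset.sum_congr rfl fun s hs => ?_
  rw [Finset.mem_range] at hs
  rw [N₂.comp_proj_of_mem (show j ≤ d - s by omega) hν]

/-- The projector is `∑_s Δ_s ⊗ Π²_{d-s}`. A condition `lam` equals the sum of the `lam ∘ (Δ_s ⊗
Π²_{d-s})`, each a combination of admissible tensors; conversely every admissible tensor is
preserved. Nesting is then visible on the spanning sets. -/
theorem PartialMaps.exists_newtonProduct [CompactSpace K₁] [CompactSpace K₂]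
    (hK₁ : closure (interior K₁) = K₁) (hK₂ : closure (interior K₂) = K₂)
    (N₁ : NewtonSequence a K₁) (N₂ : NewtonSequence a K₂) :
    ∃ N : NewtonSequence b (prodSet K₁ K₂), IsNewtonProduct N₁ N₂ N ∧
      ∀ d (μ : CmSpace a K₁ →L[ℝ] ℝ) (ν : CmSpace a K₂ →L[ℝ] ℝ) f,
        D.tens μ ν (N.proj d f) = ∑ s ∈ Finset.range (d + 1),
          D.tens (μ.comp (N₁.delta s)) (ν.comp (N₂.proj (d - s))) f := by
  have hK := closure_interior_prodSet hK₁ hK₂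
  choose T hmem htens hspan using fun d s : ℕ => D.exists_tensorOperator hK₁ hK₂ (N₁.delta_mem s)
    ((N₂.isPolyProjector (d - s)).mem)
  let P : ℕ → CmSpace b (prodSet K₁ K₂) →L[ℝ] CmSpace b (prodSet K₁ K₂) :=
    fun d => ∑ s ∈ Finset.range (d + 1), T d s
  have hP : ∀ d f, P d f = ∑ s ∈ Finset.range (d + 1), T d s f := fun d f => sum_apply _ _ _
  have hPtens : ∀ d (μ : CmSpace a K₁ →L[ℝ] ℝ) (ν : CmSpace a K₂ →L[ℝ] ℝ) f,
      D.tens μ ν (P d f) = ∑ s ∈ Finset.range (d + 1),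
        D.tens (μ.comp (N₁.delta s)) (ν.comp (N₂.proj (d - s))) f := by
    intro d μ ν f
    rw [hP, map_sum]
    exact Finset.sum_congr rfl fun s _ => htens d s μ ν f
  have hproj : ∀ d, IsPolyProjector d (P d) := by
    refine fun d => isPolyProjector_of (fun f => ?_) fun f hf => ?_
    · rw [hP]
      refine Submodule.sum_mem _ fun s hs => ?_
      have := hmem d s f
      rw [Finset.mem_range] at hs
      rwa [show s + (d - s) = d by omega] at this
    · obtain ⟨p, hp, rfl⟩ := exists_polyCm_eq hK hf
      refine CmSpace.ext_toMap hK fun z => ?_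
      obtain ⟨x, y, rfl⟩ := exists_prodPoint_eq z
      rw [← D.tens_eval, ← D.tens_eval, hPtens, D.sum_tens_polyCm hK₁ hK₂ N₁ N₂ hp]
  have hinterp : ∀ d, interpSpace (P d) =
      Submodule.span ℝ {lam | ∃ i j : ℕ, i + j ≤ d ∧ ∃ μ ∈ interpSpace (N₁.proj i),
        ∃ ν ∈ interpSpace (N₂.proj j), IsTensor μ ν lam} := by
    refine fun d => le_antisymm (fun lam hlam => ?_) (Submodule.span_le.2 ?_)
    · have h1 : lam = ∑ s ∈ Finset.range (d + 1), lam.comp (T d s) := by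
        ext f
        rw [hlam f, hP, map_sum, sum_apply]
        rfl
      rw [h1]
      refine Submodule.sum_mem _ fun s hs => ?_
      rw [Finset.mem_range] at hs
      refine Submodule.span_mono ?_ (hspan d s lam)
      rintro _ ⟨μ, ν, rfl⟩
      exact ⟨s, d - s, by omega, _, N₁.comp_delta_mem s μ, _,
        (N₂.isPolyProjector _).comp_mem ν, D.isTensor_tens _ _⟩
    · rintro lam ⟨i, j, hij, μ, hμ, ν, hν, hlam⟩ f
      rw [D.eq_tens_of_isTensor hK₁ hK₂ hlam, hPtens, ← sum_apply,
        D.sum_tens_of_mem_interpSpace N₁ N₂ hij hμ hν]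
  refine ⟨⟨P, hproj, fun d => ?_⟩, hinterp, hPtens⟩
  rw [hinterp, hinterp]
  refine Submodule.span_mono ?_
  rintro lam ⟨i, j, hij, h⟩
  exact ⟨i, j, by omega, h⟩

variable {N₁ : NewtonSequence a K₁} {N₂ : NewtonSequence a K₂}

theorem IsNewtonProduct.eq (hK : closure (interior (prodSet K₁ K₂)) = prodSet K₁ K₂)
    {N N' : NewtonSequence b (prodSet K₁ K₂)} (h : IsNewtonProduct N₁ N₂ N)
    (h' : IsNewtonProduct N₁ N₂ N') : N = N' :=
  NewtonSequence.ext_proj fun d =>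
    (N.isPolyProjector d).eq_of_interpSpace_le hK (N'.isPolyProjector d) ((h d).trans (h' d).symm).le

theorem IsTensor.comp_incl {q : ℕ} (hqb : q ≤ b) {μ : CmSpace a K₁ →L[ℝ] ℝ}
    {ν : CmSpace a K₂ →L[ℝ] ℝ} {lam : CmSpace q (prodSet K₁ K₂) →L[ℝ] ℝ} (h : IsTensor μ ν lam) :
    IsTensor μ ν (lam.comp (CmSpace.incl hqb (prodSet K₁ K₂))) :=
  fun f => h (CmSpace.incl hqb _ f)

/-- Newton products in different smoothness classes are compatible. -/
theorem IsNewtonProduct.proj_incl (hK : closure (interior (prodSet K₁ K₂)) = prodSet K₁ K₂)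
    {q : ℕ} (hqb : q ≤ b) {N : NewtonSequence q (prodSet K₁ K₂)}
    {N' : NewtonSequence b (prodSet K₁ K₂)} (h : IsNewtonProduct N₁ N₂ N)
    (h' : IsNewtonProduct N₁ N₂ N') (d : ℕ) (f : CmSpace b (prodSet K₁ K₂)) :
    N.proj d (CmSpace.incl hqb _ f) = CmSpace.incl hqb _ (N'.proj d f) := by
  have hle : ∀ lam ∈ interpSpace (N.proj d),
      lam.comp (CmSpace.incl hqb (prodSet K₁ K₂)) ∈ interpSpace (N'.proj d) := by
    intro lam hlam
    rw [h d] at hlam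
    rw [h' d]
    induction hlam using Submodule.span_induction with
    | mem lam hlam =>
      obtain ⟨i, j, hij, μ, hμ, ν, hν, ht⟩ := hlam
      exact Submodule.subset_span ⟨i, j, hij, μ, hμ, ν, hν, ht.comp_incl hqb⟩
    | zero => exact Submodule.zero_mem _
    | add l l' _ _ hl hl' => exact Submodule.add_mem _ hl hl'
    | smul c l _ hl => exact Submodule.smul_mem _ c hl
  refine CmSpace.ext_toMap hK fun z => ?_
  -- The form `g ↦ (Π_d g)(z)` is a condition of `N`, hence restricts to one of `N'`: it takes the
  -- same value on `f` and on `Π'_d f`, and the latter is a polynomial that `Π_d` reproduces.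
  have h1 := hle _ ((N.isPolyProjector d).comp_mem (CmSpace.evalCLM q z)) f
  simp only [ContinuousLinearMap.comp_apply, CmSpace.evalCLM_apply] at h1
  rw [h1]
  refine congrArg (fun g : CmSpace q (prodSet K₁ K₂) => g.toMap z) ?_
  refine (N.isPolyProjector d).apply_of_mem ?_
  obtain ⟨p, hp, hpe⟩ := exists_polyCm_eq hK ((N'.isPolyProjector d).mem f)
  rw [hpe, incl_polyCm]
  exact polyCm_mem hp

end NewtonProduct

/-! ### Uniform bounds from convergence. -/

section UniformBounds

variable {ι : Type*} [Fintype ι] [DecidableEq ι] {a m : ℕ} {K : Set (ι → ℝ)}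

theorem exists_uniform_bound {X E : Type*} [NormedAddCommGroup E] [NormedSpace ℝ E]
    [CompleteSpace E] (g : X → E →L[ℝ] ℝ) (h : ∀ f, ∃ C, ∀ i, |g i f| ≤ C) :
    ∃ A : ℝ, 0 ≤ A ∧ ∀ i f, |g i f| ≤ A * ‖f‖ := by
  obtain ⟨A, hA⟩ := banach_steinhaus (g := g) h
  refine ⟨max A 0, le_max_right _ _, fun i f => ((g i).le_opNorm f).trans ?_⟩
  gcongr
  exact (hA i).trans (le_max_left _ _)

theorem CmSpace.abs_toMap_le_norm [CompactSpace K] (f : CmSpace m K) (x : K) :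
    |f.toMap x| ≤ ‖f‖ :=
  (f.toMap.norm_coe_le_norm x).trans (norm_le_pi_norm f.1 (zeroIndex ι m))

/-- Banach–Steinhaus over all pairs `(d, x)` with `x ∈ κ` at once. For fixed `f`, uniform
convergence handles large `d`, and the finitely many remaining projections are bounded on `K`. -/
theorem NewtonSequence.ConvergingOn.exists_bound [CompactSpace K] {N : NewtonSequence a K}
    {κ : Set (ι → ℝ)} (ham : a ≤ m) (h : N.ConvergingOn κ m) :
    ∃ A : ℝ, 0 ≤ A ∧ ∀ (d : ℕ) (x : K), (x : ι → ℝ) ∈ κ → ∀ f : CmSpace m K,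
      |(N.proj d (CmSpace.incl ham K f)).toMap x| ≤ A * ‖f‖ := by
  let g : ℕ × {x : K // (x : ι → ℝ) ∈ κ} → CmSpace m K →L[ℝ] ℝ := fun i =>
    ((CmSpace.evalCLM a i.2.1).comp (N.proj i.1)).comp (CmSpace.incl ham K)
  have hg : ∀ f : CmSpace m K, ∃ C, ∀ i, |g i f| ≤ C := by
    intro f
    have hc := h (CmSpace.incl ham K f) ⟨f, rfl⟩
    rw [Metric.tendstoUniformlyOn_iff] at hc
    obtain ⟨n, hn⟩ := eventually_atTop.1 (hc 1 one_pos)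
    refine ⟨(‖f‖ + 1) + ∑ d ∈ Finset.range n, ‖N.proj d (CmSpace.incl ham K f)‖, ?_⟩
    rintro ⟨d, x, hx⟩
    change |(N.proj d (CmSpace.incl ham K f)).toMap x| ≤ _
    have hs : 0 ≤ ∑ d ∈ Finset.range n, ‖N.proj d (CmSpace.incl ham K f)‖ :=
      Finset.sum_nonneg fun _ _ => norm_nonneg _
    have hf := f.abs_toMap_le_norm x
    rcases le_or_gt n d with hd | hd
    · have h1 := hn d hd x hx
      rw [CmSpace.toMap_incl, Real.dist_eq] at h1
      have h2 := abs_sub_abs_le_abs_sub ((N.proj d (CmSpace.incl ham K f)).toMap x) (f.toMap x)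
      rw [abs_sub_comm] at h2
      linarith
    · have h1 := (N.proj d (CmSpace.incl ham K f)).abs_toMap_le_norm x
      have h2 := Finset.single_le_sum (f := fun d => ‖N.proj d (CmSpace.incl ham K f)‖)
        (fun _ _ => norm_nonneg _) (Finset.mem_range.2 hd)
      have h3 := norm_nonneg f
      linarith
  obtain ⟨A, hA, H⟩ := exists_uniform_bound (E := CmSpace m K) g hg
  exact ⟨A, hA, fun d x hx f => H (d, ⟨x, hx⟩) f⟩

theorem NewtonSequence.abs_delta_le [CompactSpace K] {N : NewtonSequence a K} {ham : a ≤ m} {A : ℝ}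
    {x : K} (h : ∀ (d : ℕ) (f : CmSpace m K), |(N.proj d (CmSpace.incl ham K f)).toMap x| ≤ A * ‖f‖)
    (hA : 0 ≤ A) (s : ℕ) (f : CmSpace m K) :
    |(N.delta s (CmSpace.incl ham K f)).toMap x| ≤ 2 * A * ‖f‖ := by
  have hAf : 0 ≤ A * ‖f‖ := by positivity
  cases s with
  | zero => exact (h 0 f).trans (by linarith)
  | succ s =>
    have h1 := abs_le.1 (h s f)
    have h2 := abs_le.1 (h (s + 1) f)
    have h3 : (N.delta (s + 1) (CmSpace.incl ham K f)).toMap x =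
        (N.proj (s + 1) (CmSpace.incl ham K f)).toMap x -
          (N.proj s (CmSpace.incl ham K f)).toMap x := rfl
    rw [h3, abs_le]
    constructor <;> linarith

end UniformBounds

/-! ### Convergence of the Newton product. -/

section Convergence

open MvPolynomial

variable {ι₁ ι₂ : Type*} [Fintype ι₁] [DecidableEq ι₁] [Fintype ι₂] [DecidableEq ι₂]
  {K₁ : Set (ι₁ → ℝ)} {K₂ : Set (ι₂ → ℝ)} {a b m : ℕ}

theorem totalDegree_partialApply_le {ι₁ ι₂ : Type*} (φ : MvPolynomial ι₂ ℝ →ₗ[ℝ] ℝ)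
    (h : MvPolynomial (ι₁ ⊕ ι₂) ℝ) : (partialApply φ h).totalDegree ≤ h.totalDegree := by
  have H : Submodule.span ℝ {p | ∃ (u : MvPolynomial ι₁ ℝ) (v : MvPolynomial ι₂ ℝ),
      u.totalDegree + v.totalDegree ≤ h.totalDegree ∧ p = mulPoly u v} ≤
      (restrictTotalDegree ι₁ ℝ h.totalDegree).comap (partialApply φ) := by
    rw [Submodule.span_le]
    rintro _ ⟨u, v, huv, rfl⟩
    rw [SetLike.mem_coe, Submodule.mem_comap, mem_restrictTotalDegree, partialApply_mulPoly]
    exact (totalDegree_smul_le _ _).trans (by omega)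
  exact (mem_restrictTotalDegree _ _ _).1 (H (mem_span_mulPoly le_rfl))

/-- Each term applies a difference to the polynomial `x ↦ (Π²_{d-s} h(x, ·))(y)`, of degree at most
`n`, hence vanishes for `s > n`. At most `n + 1` terms remain, whatever `d` is. -/
theorem PartialMaps.abs_sum_tens_le [CompactSpace K₁] [CompactSpace K₂]
    (D : PartialMaps a b K₁ K₂) (hK₁ : closure (interior K₁) = K₁)
    (hK₂ : closure (interior K₂) = K₂) {ham : a ≤ m} {N₁ : NewtonSequence a K₁}
    {N₂ : NewtonSequence a K₂} {A₁ A₂ : ℝ} (hA₁ : 0 ≤ A₁) (hA₂ : 0 ≤ A₂) {x : K₁} {y : K₂}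
    (h₁ : ∀ (d : ℕ) (f : CmSpace m K₁), |(N₁.proj d (CmSpace.incl ham K₁ f)).toMap x| ≤ A₁ * ‖f‖)
    (h₂ : ∀ (d : ℕ) (f : CmSpace m K₂), |(N₂.proj d (CmSpace.incl ham K₂ f)).toMap y| ≤ A₂ * ‖f‖)
    {h : MvPolynomial (ι₁ ⊕ ι₂) ℝ} {n : ℕ} (hn : h.totalDegree ≤ n) {c : ℝ} (hc : 0 ≤ c)
    (hb : MixedBound m K₁ K₂ h c) (d : ℕ) :
    |∑ s ∈ Finset.range (d + 1), D.tens ((CmSpace.evalCLM a x).comp (N₁.delta s))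
      ((CmSpace.evalCLM a y).comp (N₂.proj (d - s))) (polyCm b (prodSet K₁ K₂) h)| ≤
      (n + 1) * (2 * A₁ * (A₂ * c)) := by
  have key : ∀ s t, |D.tens ((CmSpace.evalCLM a x).comp (N₁.delta s))
      ((CmSpace.evalCLM a y).comp (N₂.proj t)) (polyCm b (prodSet K₁ K₂) h)| ≤
      if s < n + 1 then 2 * A₁ * (A₂ * c) else 0 := by
    intro s t
    rw [D.tens_apply, D.part_polyCm hK₁ hK₂, ContinuousLinearMap.comp_apply]
    split_ifs with hs
    · have e := hb.norm_partialApply_le hc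
        (φ := polyForm ((CmSpace.evalCLM a y).comp (N₂.proj t))) hA₂
        fun v => h₂ t (polyCm m K₂ v)
      exact (NewtonSequence.abs_delta_le h₁ hA₁ s (polyCm m K₁ _)).trans (by gcongr)
    · rw [N₁.delta_apply_eq_zero (i := n) (by omega)
        (polyCm_mem ((totalDegree_partialApply_le _ _).trans hn)), map_zero, abs_zero]
  refine (Finset.abs_sum_le_sum_abs _ _).trans
    ((Finset.sum_le_sum fun s _ => key s (d - s)).trans ?_)
  rw [← Finset.sum_filter, Finset.sum_const, nsmul_eq_mul]
  gcongr
  have : (Finset.range (d + 1)).filter (fun s => s < n + 1) ⊆ Finset.range (n + 1) := fun s hs =>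
    Finset.mem_range.2 (Finset.mem_filter.1 hs).2
  have h3 := Finset.card_le_card this
  rw [Finset.card_range] at h3
  exact_mod_cast h3

/-- A sequence whose increments decay geometrically stays close to each of its terms. -/
theorem abs_sub_le_of_geometric {u : ℕ → ℝ} {C ρ : ℝ} (hρ1 : ρ < 1)
    (h : ∀ l, |u (l + 1) - u l| ≤ C * ρ ^ l) {L : ℝ} (hu : Tendsto u atTop (𝓝 L)) (k : ℕ) :
    |L - u k| ≤ C * ρ ^ k / (1 - ρ) := by
  have := dist_le_of_le_geometric_of_tendsto ρ C hρ1 (f := u)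
    (fun l => by rw [Real.dist_eq, abs_sub_comm]; exact h l) hu k
  rwa [Real.dist_eq, abs_sub_comm] at this

theorem IsNewtonProduct.convergingOn_of_tens [CompactSpace K₁] [CompactSpace K₂]
    (D : PartialMaps a b K₁ K₂) (hK₁ : closure (interior K₁) = K₁)
    (hK₂ : closure (interior K₂) = K₂) (ham : a ≤ m) {N₁ : NewtonSequence a K₁}
    {N₂ : NewtonSequence a K₂} {κ₁ : Set (ι₁ → ℝ)} {κ₂ : Set (ι₂ → ℝ)}
    (h₁ : N₁.ConvergingOn κ₁ m) (h₂ : N₂.ConvergingOn κ₂ m) {τ : ℝ} (hτ : 0 ≤ τ) (hτ2 : τ < 1 / 2)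
    (happ : ∀ f : CmSpace b (prodSet K₁ K₂), ∃ A : ℝ, 0 ≤ A ∧ ∃ P, IsGeomApprox m τ A f P)
    {N : NewtonSequence b (prodSet K₁ K₂)}
    (hN : ∀ d (μ : CmSpace a K₁ →L[ℝ] ℝ) (ν : CmSpace a K₂ →L[ℝ] ℝ) f,
      D.tens μ ν (N.proj d f) = ∑ s ∈ Finset.range (d + 1),
        D.tens (μ.comp (N₁.delta s)) (ν.comp (N₂.proj (d - s))) f) :
    N.ConvergingOn (prodSet κ₁ κ₂) b := by
  intro f _
  obtain ⟨A₁, hA₁, H₁⟩ := h₁.exists_bound ham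
  obtain ⟨A₂, hA₂, H₂⟩ := h₂.exists_bound ham
  obtain ⟨A, hA, P, hP⟩ := happ f
  have hτ1 : τ < 1 := by linarith
  -- The factor `2` absorbs the number of terms, at most `2^(l+1) + 1 ≤ 3 * 2^l`, which is also the
  -- origin of the `3` in `C`.
  set ρ : ℝ := 2 * τ with hρdef
  have hρ : 0 ≤ ρ := by positivity
  have hρ1 : ρ < 1 := by linarith
  set C : ℝ := 3 * (2 * A₁ * (A₂ * A)) with hCdef
  have hC : 0 ≤ C := by positivity
  have bound : ∀ (k d : ℕ), 2 ^ k ≤ d → ∀ z : prodSet K₁ K₂, (z : ι₁ ⊕ ι₂ → ℝ) ∈ prodSet κ₁ κ₂ →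
      |f.toMap z - (N.proj d f).toMap z| ≤ (C / (1 - ρ) + A) * ρ ^ k := by
    intro k d hkd z hz
    obtain ⟨x, y, rfl⟩ := exists_prodPoint_eq z
    have hx : (x : ι₁ → ℝ) ∈ κ₁ := hz.1
    have hy : (y : ι₂ → ℝ) ∈ κ₂ := hz.2
    let Λ : CmSpace b (prodSet K₁ K₂) →L[ℝ] ℝ := ∑ s ∈ Finset.range (d + 1),
      D.tens ((CmSpace.evalCLM a x).comp (N₁.delta s))
        ((CmSpace.evalCLM a y).comp (N₂.proj (d - s)))
    have hΛ : ∀ g, Λ g = ∑ s ∈ Finset.range (d + 1),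
      D.tens ((CmSpace.evalCLM a x).comp (N₁.delta s))
        ((CmSpace.evalCLM a y).comp (N₂.proj (d - s))) g := fun g => sum_apply _ _ _
    have hΛN : ∀ g, (N.proj d g).toMap (prodPoint x y) = Λ g := fun g => by
      rw [← D.tens_eval, hN, hΛ]
    -- The value of `Π_d f` is thus `P_k` plus the images of the later increments, with `P_k`
    -- reproduced because `2 ^ k ≤ d`.
    have hlim : Tendsto (fun l => Λ (polyCm b (prodSet K₁ K₂) (P l))) atTop (𝓝 (Λ f)) := by
      simp only [hΛ]
      exact tendsto_finsetSum _ fun s _ => D.tendsto_tens hK₁ hK₂ ham hA hτ hτ1 hP _ _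
    have hinc : ∀ l, |Λ (polyCm b (prodSet K₁ K₂) (P (l + 1))) -
        Λ (polyCm b (prodSet K₁ K₂) (P l))| ≤ C * ρ ^ l := by
      intro l
      have hdeg : (P (l + 1) - P l).totalDegree ≤ 2 ^ (l + 1) :=
        (totalDegree_sub _ _).trans (max_le (hP.totalDegree_le _)
          ((hP.totalDegree_le l).trans (Nat.pow_le_pow_right two_pos l.le_succ)))
      rw [← map_sub, ← map_sub, hΛ]
      refine (D.abs_sum_tens_le hK₁ hK₂ hA₁ hA₂ (fun d' g => H₁ d' x hx g)
        (fun d' g => H₂ d' y hy g) hdeg (by positivity) (hP.mixedBound l) d).trans ?_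
      have h2 : (1 : ℝ) ≤ 2 ^ l := one_le_pow₀ one_le_two
      have h3 : ((2 ^ (l + 1) : ℕ) : ℝ) + 1 ≤ 3 * 2 ^ l := by
        push_cast
        rw [pow_succ]
        linarith
      calc (((2 ^ (l + 1) : ℕ) : ℝ) + 1) * (2 * A₁ * (A₂ * (A * τ ^ l)))
          ≤ (3 * 2 ^ l) * (2 * A₁ * (A₂ * (A * τ ^ l))) := by gcongr
        _ = C * ρ ^ l := by rw [hCdef, hρdef, mul_pow]; ring
    have e1 := abs_sub_le_of_geometric hρ1 hinc hlim k
    have e2 : Λ (polyCm b (prodSet K₁ K₂) (P k)) = eval (prodPoint x y : ι₁ ⊕ ι₂ → ℝ) (P k) := by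
      rw [← hΛN, N.proj_apply_of_mem hkd (polyCm_mem (hP.totalDegree_le k)), toMap_polyCm]
    have e3 := hP.abs_sub_le k (prodPoint x y)
    have e4 : A * τ ^ k ≤ A * ρ ^ k := by
      gcongr
      linarith
    rw [e2] at e1
    rw [hΛN]
    have e5 : (C / (1 - ρ) + A) * ρ ^ k = C * ρ ^ k / (1 - ρ) + A * ρ ^ k := by ring
    rw [e5]
    rw [abs_le] at e1 e3 ⊢
    constructor <;> linarith
  rw [Metric.tendstoUniformlyOn_iff]
  intro ε hε
  have h0 : Tendsto (fun k => (C / (1 - ρ) + A) * ρ ^ k) atTop (𝓝 0) := by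
    simpa using (tendsto_pow_atTop_nhds_zero_of_lt_one hρ hρ1).const_mul (C / (1 - ρ) + A)
  obtain ⟨k, hk⟩ := ((tendsto_order.1 h0).2 ε hε).exists
  filter_upwards [eventually_ge_atTop (2 ^ k)] with d hd z hz
  rw [Real.dist_eq]
  exact (bound k d hd z hz).trans_lt hk

end Convergence

/-! ### Assembly of the theorem. -/

theorem IsSBM.nonempty {ι : Type*} [Fintype ι] {K : Set (ι → ℝ)} {θ : ℝ} (h : IsSBM K θ) :
    K.Nonempty := by
  obtain ⟨-, μ, hμ, hK, -⟩ := h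
  by_contra hne
  rw [Set.not_nonempty_iff_eq_empty] at hne
  rw [hne, Set.compl_empty, measure_univ] at hK
  exact one_ne_zero hK

end

theorem mainTheorem5 (n₁ n₂ : ℕ) (hn₁ : 0 < n₁) (hn₂ : 0 < n₂)
    (K₁ κ₁ : Set (Fin n₁ → ℝ)) (K₂ κ₂ : Set (Fin n₂ → ℝ))
    (hK₁ : IsFatCompact K₁) (hK₂ : IsFatCompact K₂)
    (hκ₁ : IsCompact κ₁) (hκ₂ : IsCompact κ₂) (hκK₁ : κ₁ ⊆ K₁) (hκK₂ : κ₂ ⊆ K₂)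
    (θ₁ θ₂ r₁ r₂ : ℝ)
    (hθ₁ : IsSBM K₁ θ₁) (hθ₂ : IsSBM K₂ θ₂)
    (hr₁ : SatisfiesMarkov K₁ r₁) (hr₂ : SatisfiesMarkov K₂ r₂)
    (hJ : IsJackson (prodSet K₁ K₂))
    (mbar m M : ℕ) (hm : mbar ≤ m)
    (N₁ : NewtonSequence mbar K₁) (N₂ : NewtonSequence mbar K₂)
    (hN₁ : N₁.ConvergingOn κ₁ m) (hN₂ : N₂.ConvergingOn κ₂ m)
    (hM : (M : ℝ) > 3 / 2 + (θ₁ + θ₂) + (m : ℝ) * (r₁ + r₂)) :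
    (∃! N : NewtonSequence M (prodSet K₁ K₂), IsNewtonProduct N₁ N₂ N) ∧
    ∀ q : ℕ, q ≤ M → ∀ N : NewtonSequence q (prodSet K₁ K₂), IsNewtonProduct N₁ N₂ N →
      N.ConvergingOn (prodSet κ₁ κ₂) M := by
  have : CompactSpace K₁ := isCompact_iff_compactSpace.1 hK₁.1
  have : CompactSpace K₂ := isCompact_iff_compactSpace.1 hK₂.1
  have : CompactSpace (prodSet K₁ K₂) :=
    isCompact_iff_compactSpace.1 (isCompact_prodSet hK₁.1 hK₂.1)
  have : Nonempty (Fin n₁) := ⟨⟨0, hn₁⟩⟩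
  have : Nonempty (Fin n₂) := ⟨⟨0, hn₂⟩⟩
  have hK := closure_interior_prodSet hK₁.2 hK₂.2
  -- Positivity of the `θ_s` yields `M > 1 + m(r₁+r₂)`, and the probability measures make the `K_s`
  -- nonempty, so the Markov exponents are nonnegative.
  obtain ⟨τ, hτ, hτ2, happ⟩ := exists_isGeomApprox hJ hr₁ hr₂ (hr₁.exponent_nonneg hθ₁.nonempty)
    (hr₂.exponent_nonneg hθ₂.nonempty) (m := m) (b := M) (by linarith [hθ₁.1, hθ₂.1])
  obtain ⟨D⟩ := nonempty_partialMaps hK₁.2 hK₂.2 hm hτ (by linarith) happ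
  obtain ⟨N', hN', htens⟩ := D.exists_newtonProduct hK₁.2 hK₂.2 N₁ N₂
  refine ⟨⟨N', hN', fun N hN => hN.eq hK hN'⟩, fun q hq N hN f hf => ?_⟩
  obtain ⟨g, hg⟩ := hf
  have hfg : f = CmSpace.incl hq _ g := CmSpace.ext_toMap hK fun z => by
    rw [CmSpace.toMap_incl, hg]
  have hconv := IsNewtonProduct.convergingOn_of_tens D hK₁.2 hK₂.2 hm hN₁ hN₂ hτ hτ2 happ htens g
    ⟨g, rfl⟩
  rw [hfg]
  simp only [hN.proj_incl hK hq hN', CmSpace.toMap_incl]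
  exact hconv
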